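/- Let ${\bf A}=({\bf A}_{ij})_{i,j\ge 0}$ be the infinite real matrix with entries \[ {\bf A}_{0,0}=\tfrac12,\quad {\bf A}_{0,1}=-1,\quad {\bf A}_{0,j}=0\ (j\ge 2), \] \[ {\bf A}_{1,0}=\frac{\pi^2}{12}+\sum_{k\ge1}\frac{(-1)^k}{k^2 2^k}-\frac{\log 2}{2},\quad {\bf A}_{1,1}=\tfrac12+\log 2,\quad {\bf A}_{1,k+1}=\frac1k+\frac{(-1)^k}{2^{k+1}}-\frac1{k2^k}\ (k\ge1), \] \[ {\bf A}_{r+1,0}=\frac{(-1)^r}{r}\sum_{j\ge r}\frac1{j3^j},\quad {\bf A}_{r+1,1}=0,\quad {\bf A}_{r+1,k+1}=\binom kr\Big(\frac{(-1)^{k-r}}{2^{k+1}}-\frac1{k2^k}\Big)\quad (r,k\ge1), \] where $\binom kr=0$ for $k<r$, and let ${\bf A}_n$ be its $(n+1)\times(n+1)$ principal submatrix with indices $0,\dots,n$. For $\rho\ge1$ let $\ell^1_\rho$ be the space of real sequences $x=(x_i)_{i\ge0}$ with $\|x\|_{1,\rho}=\sum_i\rho^i|x_i|<\infty$. Vectors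 in $\mathbb R^{n+1}$ are regarded as sequences by padding with zeroes. Call an eigenvalue $\lambda$ of a real square matrix its maximum eigenvalue if $\lambda$ is real and every other complex eigenvalue $\mu$ of the matrix satisfies $|\mu|<\lambda$. Fix $c\in\{0,1\}$. For every $n\ge 7$ there is exactly one triple $(\lambda_n,{\bf v}_n,{\bf w}_n)$ such that $\lambda_n$ is the maximum eigenvalue of ${\bf A}_n$, and ${\bf v}_n,{\bf w}_n\in\mathbb R^{n+1}$ are corresponding right and left eigenvectors, ${\bf A}_n{\bf v}_n=\lambda_n{\bf v}_n$ and ${\bf w}_n{\bf A}_n=\lambda_n{\bf w}_n$, normalized by $({\bf v}_n)_c=({\bf w}_n)_c=1$. As $n\to\infty$, the sequence $(\lambda_n)$ converges; there is a sequence ${\bf v}$, belonging to $\ell^1_\rho$ for every $1\le\rho\le3$, such that ${\bf v}_n\to{\bf v}$ in $\ell^1_\rho$ for every $1\le\rho\le3$; and $({\bf w}_n)$ converges in $\ell^\infty$. -/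

import Mathlib

open Filter Topology
open scoped ENNReal

noncomputable section

/-- The infinite coefficient matrix `A`, rows and columns indexed from `0`. Row and column `0` belong
to the coefficient of `log t`, row and column `k + 1` to the coefficient of `(t - 1) ^ k`. In the
last line `(-1) ^ (k + r)` is the sign `(-1) ^ ((k + 1) - (r + 1))`; the binomial coefficient
vanishes for `k < r`. -/
def parkingMatrix : ℕ → ℕ → ℝ
  | 0, 0 => 1 / 2
  | 0, 1 => -1
  | 0, _ + 2 => 0
  | 1, 0 => Real.pi ^ 2 / 12 + (∑' k : ℕ, (-1 : ℝ) ^ (k + 1) / (((k : ℝ) + 1) ^ 2 * 2 ^ (k + 1)))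
      - Real.log 2 / 2
  | 1, 1 => 1 / 2 + Real.log 2
  | 1, k + 2 => 1 / ((k : ℝ) + 1) + (-1 : ℝ) ^ (k + 1) / 2 ^ (k + 2)
      - 1 / (((k : ℝ) + 1) * 2 ^ (k + 1))
  | r + 2, 0 => (-1 : ℝ) ^ (r + 1) / ((r : ℝ) + 1)
      * ∑' j : ℕ, 1 / (((r : ℝ) + 1 + j) * 3 ^ (r + 1 + j))
  | _ + 2, 1 => 0
  | r + 2, k + 2 => (Nat.choose (k + 1) (r + 1) : ℝ)
      * ((-1 : ℝ) ^ (k + r) / 2 ^ (k + 2) - 1 / (((k : ℝ) + 1) * 2 ^ (k + 1)))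

/-- The `(n + 1) × (n + 1)` principal submatrix `A_n`. -/
def parkingTrunc (n : ℕ) : Matrix (Fin (n + 1)) (Fin (n + 1)) ℝ :=
  Matrix.of fun i j => parkingMatrix i j

/-- `lam` is an eigenvalue of the real matrix `B`, and all other complex eigenvalues of `B` are
smaller than `lam` in absolute value. -/
def IsMaxEigenvalue {m : ℕ} (B : Matrix (Fin m) (Fin m) ℝ) (lam : ℝ) : Prop :=
  Module.End.HasEigenvalue (Matrix.toLin' (B.map (algebraMap ℝ ℂ))) (lam : ℂ) ∧
    ∀ μ : ℂ, Module.End.HasEigenvalue (Matrix.toLin' (B.map (algebraMap ℝ ℂ))) μ →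
      μ ≠ (lam : ℂ) → ‖μ‖ < lam

/-- A finite vector, padded by zeroes to a sequence. -/
def padZero {m : ℕ} (x : Fin m → ℝ) (i : ℕ) : ℝ :=
  if h : i < m then x ⟨i, h⟩ else 0

/-- `lam` is the maximum eigenvalue of `A_n`, and `v`, `w` are corresponding right and left
eigenvectors whose entries with index `c` are equal to `1` (so that they are nonzero). -/
structure IsMaxEigentriple (n c : ℕ) (lam : ℝ) (v w : Fin (n + 1) → ℝ) : Prop where
  isMax : IsMaxEigenvalue (parkingTrunc n) lam
  right : Matrix.mulVec (parkingTrunc n) v = lam • v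
  left : Matrix.vecMul w (parkingTrunc n) = lam • w
  right_norm : padZero v c = 1
  left_norm : padZero w c = 1

/-- Membership in the weighted space `ℓ¹_ρ`. -/
def MemEllOne (ρ : ℝ) (x : ℕ → ℝ) : Prop :=
  Summable fun i => ρ ^ i * |x i|

/-- The norm of `ℓ¹_ρ`. -/
def ellOneNorm (ρ : ℝ) (x : ℕ → ℝ) : ℝ :=
  ∑' i, ρ ^ i * |x i|

theorem memlp_padZero {m : ℕ} (x : Fin m → ℝ) : Memℓp (padZero x) ∞ := by
  refine memℓp_infty ⟨∑ i, |x i|, ?_⟩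
  rintro _ ⟨i, rfl⟩
  by_cases h : i < m
  · simpa [padZero, h] using
      Finset.single_le_sum (f := fun i => |x i|) (fun _ _ => abs_nonneg _)
        (Finset.mem_univ (⟨i, h⟩ : Fin m))
  · simpa [padZero, h] using Finset.sum_nonneg fun i _ => abs_nonneg (x i)

/-- A finite vector, padded by zeroes, as an element of `ℓ^∞`. -/
def padEllInfty {m : ℕ} (x : Fin m → ℝ) : lp (fun _ : ℕ => ℝ) ∞ :=
  ⟨padZero x, memlp_padZero x⟩

end

/-! Split off indices `0` and `1`. The remaining block `T` is upper triangular, and each of its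
columns has `ℓ¹` norm at most `1/2`. So `l - T` is invertible for `|l| > 1/2`, with bounds
independent of the truncation: on columns in every weighted `ℓ¹` with weight at least `1`
(`sum_le_of_le_add_block`), and on rows in `ℓ^∞` (`le_of_le_add_block_transpose`).

By triangularity the row solution `leftSol l` does not depend on the truncation. With `w_1 = 1`,
columns `1, 2, ...` of the left eigenvector equation determine `w`, and column `0` becomes the
scalar equation `charFun m l = 0`. Explicit estimates give a sign change of `charFun` between `6/5`
and `2`, hence a root `mu`.

The main tool is the pairing of a right eigenvector `v` (eigenvalue `lam`, `v_0 = 1`) with the left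
eigenvector `w` of the same or a larger truncation (eigenvalue `mu`). It yields `(lam - mu) * F` = a
tail of column `0`, where `F = -w·v`, and `|F| ≥ 1/10` once `|lam| ≥ 6/5` (`IsRightSystem.pairing`,
`IsRightSystem.norm_pairing_factor_ge`). For equal sizes the tail is empty, so `mu` is the only
eigenvalue of modulus at least `6/5`, which makes it maximal. For different sizes the tail bounds
the difference of the maximum eigenvalues, so these form a Cauchy sequence.

Column `0` lies in `ℓ¹_3`, so the resolvent bound makes the right eigenvectors Cauchy there. The
left eigenvectors converge in `ℓ^∞` because `leftSol` is Lipschitz in `l` uniformly in the index and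
tends to zero (`tendsto_leftSol`), so that cutting it off costs little. -/

noncomputable section

/-- The block of the coefficient matrix with rows and columns from `2` on. -/
def parkingBlock (r k : ℕ) : ℝ := parkingMatrix (r + 2) (k + 2)

/-- Row `1` of the coefficient matrix, from column `2` on. -/
def parkingRow (k : ℕ) : ℝ := parkingMatrix 1 (k + 2)

/-- Column `0` of the coefficient matrix, from row `2` on. -/
def parkingCol (r : ℕ) : ℝ := parkingMatrix (r + 2) 0

/-- The entry `A_{1,0}`. -/
def parkingCorner : ℝ := parkingMatrix 1 0

/-- The entry `A_{1,1}`. -/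
def parkingDiag : ℝ := parkingMatrix 1 1

/-! ### Bounds for the entries -/

theorem parkingBlock_eq (r k : ℕ) : parkingBlock r k = (Nat.choose (k + 1) (r + 1) : ℝ)
      * ((-1 : ℝ) ^ (k + r) / 2 ^ (k + 2) - 1 / (((k : ℝ) + 1) * 2 ^ (k + 1))) := by
  simp [parkingBlock, parkingMatrix]

theorem parkingBlock_eq_zero {r k : ℕ} (h : k < r) : parkingBlock r k = 0 := by
  rw [parkingBlock_eq, Nat.choose_eq_zero_of_lt (by omega)]; simp

/-- For `k ≥ 1` one has `2 / (k + 1) ≤ 1`, so the term with the alternating sign dominates and fixes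
the sign of the entry. -/
theorem parkingBlock_abs_eq {r k : ℕ} (hk : 1 ≤ k) : |parkingBlock r k| =
    (Nat.choose (k + 1) (r + 1) : ℝ) *
      (1 - (-1 : ℝ) ^ (k + r) * (2 / ((k : ℝ) + 1))) / 2 ^ (k + 2) := by
  have hk' : (1 : ℝ) ≤ k := by exact_mod_cast hk
  have h2 : 2 / ((k : ℝ) + 1) ≤ 1 := by rw [div_le_one (by positivity)]; linarith
  have h0 : 0 ≤ 2 / ((k : ℝ) + 1) := by positivity
  have key : (-1 : ℝ) ^ (k + r) / 2 ^ (k + 2) - 1 / (((k : ℝ) + 1) * 2 ^ (k + 1)) =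
      ((-1 : ℝ) ^ (k + r) - 2 / ((k : ℝ) + 1)) / 2 ^ (k + 2) := by
    field_simp; ring
  rw [parkingBlock_eq, key, abs_mul, abs_div, Nat.abs_cast,
    abs_of_pos (by positivity : (0:ℝ) < 2 ^ (k + 2)),
    mul_div_assoc]
  congr 2
  rcases neg_one_pow_eq_or ℝ (k + r) with h | h <;> rw [h]
  · rw [abs_of_nonneg (by linarith)]; ring
  · rw [abs_of_nonpos (by linarith)]; ring

/-- Extended to the full range of binomial coefficients, the column sum is `2 ^ (k + 1) / 2 ^ (k +
2)`, since the alternating part cancels; the added term is nonnegative. Column `0`, where the sign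
formula fails, has the single entry `-1/4`. -/
theorem sum_abs_parkingBlock_range_succ (k : ℕ) :
    ∑ r ∈ Finset.range (k + 1), |parkingBlock r k| ≤ 1 / 2 := by
  rcases Nat.eq_zero_or_pos k with rfl | hk
  · norm_num [parkingBlock_eq, abs_le]
  · have hk' : (1 : ℝ) ≤ k := by exact_mod_cast hk
    have h2 : 2 / ((k : ℝ) + 1) ≤ 1 := by rw [div_le_one (by positivity)]; linarith
    have h0 : 0 ≤ 2 / ((k : ℝ) + 1) := by positivity
    simp_rw [parkingBlock_abs_eq hk, ← Finset.sum_div]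
    set q := 2 / ((k : ℝ) + 1)
    have e1 : ∑ j ∈ Finset.range (k + 1 + 1), (Nat.choose (k + 1) j : ℝ) *
        (1 + (-1 : ℝ) ^ (k + j) * q) = 2 ^ (k + 1) := by
      have s1 : ∑ j ∈ Finset.range (k + 1 + 1), (Nat.choose (k + 1) j : ℝ) = 2 ^ (k + 1) := by
        exact_mod_cast Nat.sum_range_choose (k + 1)
      have s2 : ∑ j ∈ Finset.range (k + 1 + 1), (-1 : ℝ) ^ j * (Nat.choose (k + 1) j : ℝ) = 0 := by
        have := Int.alternating_sum_range_choose (n := k + 1)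
        rw [if_neg (by omega)] at this
        exact_mod_cast this
      calc _ = ∑ j ∈ Finset.range (k + 1 + 1), (Nat.choose (k + 1) j : ℝ) + (-1) ^ k * q *
            ∑ j ∈ Finset.range (k + 1 + 1), (-1 : ℝ) ^ j * (Nat.choose (k + 1) j : ℝ) := by
            rw [Finset.mul_sum, ← Finset.sum_add_distrib]
            refine Finset.sum_congr rfl fun j _ => ?_
            rw [pow_add]; ring
        _ = _ := by rw [s1, s2]; ring
    rw [Finset.sum_range_succ'] at e1
    have e2 : 0 ≤ (Nat.choose (k + 1) 0 : ℝ) * (1 + (-1 : ℝ) ^ (k + 0) * q) := by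
      rcases neg_one_pow_eq_or ℝ (k + 0) with h | h <;> rw [h] <;> simp <;> linarith
    have e3 : ∑ r ∈ Finset.range (k + 1), (Nat.choose (k + 1) (r + 1) : ℝ) *
        (1 - (-1 : ℝ) ^ (k + r) * q) ≤ 2 ^ (k + 1) := by
      rw [← e1]
      refine le_trans (le_of_eq (Finset.sum_congr rfl fun j _ => ?_)) (le_add_of_nonneg_right e2)
      rw [← add_assoc, pow_succ]; ring
    rw [div_le_iff₀ (by positivity)]
    refine e3.trans (le_of_eq ?_)
    rw [pow_succ 2 (k + 1)]; ring

/-- The columns of the block have `ℓ¹` norm at most `1 / 2`. -/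
theorem sum_abs_parkingBlock_le (k m : ℕ) :
    ∑ r ∈ Finset.range m, |parkingBlock r k| ≤ 1 / 2 := by
  refine le_trans ?_ (sum_abs_parkingBlock_range_succ k)
  rcases le_total m (k + 1) with h | h
  · exact Finset.sum_le_sum_of_subset_of_nonneg (Finset.range_subset_range.2 h)
      fun _ _ _ => abs_nonneg _
  · refine le_of_eq (Finset.sum_subset (Finset.range_subset_range.2 h) fun r _ hr => ?_).symm
    rw [parkingBlock_eq_zero (by simpa using hr), abs_zero]

theorem abs_parkingBlock_diag_le (k : ℕ) : |parkingBlock k k| ≤ 1 / 2 :=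
  (Finset.single_le_sum (f := fun r => |parkingBlock r k|) (fun _ _ => abs_nonneg _)
    (Finset.self_mem_range_succ k)).trans (sum_abs_parkingBlock_le k (k + 1))

theorem tendsto_choose_div_two_pow (r : ℕ) :
    Tendsto (fun k : ℕ => (Nat.choose k r : ℝ) / 2 ^ k) atTop (𝓝 0) := by
  have h : Tendsto (fun k : ℕ => (k : ℝ) ^ r / 2 ^ k) atTop (𝓝 0) :=
    tendsto_pow_const_div_const_pow_of_one_lt r (by norm_num)
  refine squeeze_zero (fun k => by positivity) (fun k => ?_) h
  gcongr
  exact_mod_cast Nat.choose_le_pow k r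

theorem tendsto_parkingBlock_row (r : ℕ) :
    Tendsto (fun k => |parkingBlock r k|) atTop (𝓝 0) := by
  have h := (tendsto_add_atTop_iff_nat 1).2 (tendsto_choose_div_two_pow (r + 1))
  refine squeeze_zero' (Eventually.of_forall fun k => abs_nonneg _) ?_ h
  filter_upwards [eventually_ge_atTop 1] with k hk
  rw [parkingBlock_abs_eq hk]
  have hk' : (1 : ℝ) ≤ k := by exact_mod_cast hk
  have h2 : 2 / ((k : ℝ) + 1) ≤ 1 := by rw [div_le_one (by positivity)]; linarith
  have h0 : 0 ≤ 2 / ((k : ℝ) + 1) := by positivity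
  have h3 : 1 - (-1 : ℝ) ^ (k + r) * (2 / ((k : ℝ) + 1)) ≤ 2 := by
    rcases neg_one_pow_eq_or ℝ (k + r) with h | h <;> rw [h] <;> linarith
  rw [div_le_div_iff₀ (by positivity) (by positivity), pow_succ 2 (k + 1)]
  have : (0 : ℝ) ≤ (k + 1).choose (r + 1) * 2 ^ (k + 1) := by positivity
  nlinarith

theorem parkingRow_eq (k : ℕ) : parkingRow k = 1 / ((k : ℝ) + 1) + (-1 : ℝ) ^ (k + 1) / 2 ^ (k + 2)
      - 1 / (((k : ℝ) + 1) * 2 ^ (k + 1)) := by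
  simp [parkingRow, parkingMatrix]

theorem abs_parkingRow_le_add (k : ℕ) :
    |parkingRow k| ≤ 1 / ((k : ℝ) + 1) + (1 / 2) ^ (k + 2) := by
  have e : parkingRow k = 1 / ((k : ℝ) + 1) * (1 - (1 / 2) ^ (k + 1)) +
      (-1) ^ (k + 1) * (1 / 2) ^ (k + 2) := by
    rw [parkingRow_eq, one_div_pow, one_div_pow]; field_simp
    ring
  have h1 : (1 / 2 : ℝ) ^ (k + 1) ≤ 1 := pow_le_one₀ (by norm_num) (by norm_num)
  have h2 : (0 : ℝ) ≤ (1 / 2 : ℝ) ^ (k + 1) := by positivity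
  rw [e]
  refine (abs_add_le _ _).trans (add_le_add ?_ ?_)
  · rw [abs_of_nonneg (mul_nonneg (by positivity) (by linarith))]
    exact mul_le_of_le_one_right (by positivity) (by linarith)
  · rw [abs_mul, abs_pow, abs_neg, abs_one, one_pow, one_mul, abs_of_nonneg (by positivity)]

theorem abs_parkingRow_le (k : ℕ) : |parkingRow k| ≤ 1 / 2 := by
  -- The general bound is too weak for the first two entries, which equal `1/4` and `1/2`.
  match k with
  | 0 => rw [parkingRow_eq]; norm_num [abs_le]
  | 1 => rw [parkingRow_eq]; norm_num [abs_le]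
  | k + 2 =>
    refine (abs_parkingRow_le_add _).trans ?_
    have h1 : 1 / (((k + 2 : ℕ) : ℝ) + 1) ≤ 1 / 3 := by
      apply one_div_le_one_div_of_le (by norm_num)
      push_cast; linarith [(Nat.cast_nonneg k : (0 : ℝ) ≤ k)]
    have h2 : (1 / 2 : ℝ) ^ (k + 2 + 2) ≤ (1 / 2) ^ 4 :=
      pow_le_pow_of_le_one (by norm_num) (by norm_num) (by omega)
    norm_num at h1 h2 ⊢
    linarith

theorem tendsto_abs_parkingRow : Tendsto (fun k => |parkingRow k|) atTop (𝓝 0) := by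
  have h : Tendsto (fun k : ℕ => 1 / ((k : ℝ) + 1) + (1 / 2 : ℝ) ^ (k + 2)) atTop (𝓝 (0 + 0)) :=
    tendsto_one_div_add_atTop_nhds_zero_nat.add
      ((tendsto_add_atTop_iff_nat 2).2
        (tendsto_pow_atTop_nhds_zero_of_lt_one (by norm_num) (by norm_num)))
  rw [add_zero] at h
  exact squeeze_zero (fun k => abs_nonneg _) abs_parkingRow_le_add h

/-- The tail `∑_{j ≥ r + 1} 1 / (j 3 ^ j)` of the logarithmic series. -/
def logTail (r : ℕ) : ℝ := ∑' j : ℕ, 1 / (((r : ℝ) + 1 + j) * 3 ^ (r + 1 + j))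

theorem parkingCol_eq (r : ℕ) :
    parkingCol r = (-1 : ℝ) ^ (r + 1) / ((r : ℝ) + 1) * logTail r := by
  simp [parkingCol, parkingMatrix, logTail]

theorem logTail_term_le (r j : ℕ) : 1 / (((r : ℝ) + 1 + j) * 3 ^ (r + 1 + j)) ≤
    1 / (((r : ℝ) + 1) * 3 ^ (r + 1)) * (1 / 3) ^ j := by
  rw [one_div_pow, ← one_div_mul_one_div, pow_add, ← one_div_mul_one_div,
    ← one_div_mul_one_div, mul_assoc]
  have : 1 / ((r : ℝ) + 1 + j) ≤ 1 / ((r : ℝ) + 1) :=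
    one_div_le_one_div_of_le (by positivity) (by linarith [(Nat.cast_nonneg j : (0 : ℝ) ≤ j)])
  gcongr

theorem summable_logTail (r : ℕ) :
    Summable fun j : ℕ => 1 / (((r : ℝ) + 1 + j) * 3 ^ (r + 1 + j)) :=
  Summable.of_nonneg_of_le (fun _ => by positivity) (logTail_term_le r)
    ((summable_geometric_of_lt_one (by norm_num) (by norm_num)).mul_left _)

theorem logTail_nonneg (r : ℕ) : 0 ≤ logTail r := tsum_nonneg fun _ => by positivity

theorem logTail_le (r : ℕ) : logTail r ≤ 1 / (2 * ((r : ℝ) + 1) * 3 ^ r) := by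
  refine ((summable_logTail r).tsum_le_tsum (logTail_term_le r)
    ((summable_geometric_of_lt_one (by norm_num) (by norm_num)).mul_left _)).trans ?_
  rw [tsum_mul_left, tsum_geometric_of_lt_one (by norm_num) (by norm_num), pow_succ]
  apply le_of_eq
  field_simp
  norm_num

theorem le_logTail_zero : 65 / 162 ≤ logTail 0 := by
  refine le_trans ?_ ((summable_logTail 0).sum_le_tsum (Finset.range 3) fun _ _ => by positivity)
  norm_num [Finset.sum_range_succ]

theorem abs_parkingCol_le (r : ℕ) : |parkingCol r| ≤ 1 / (2 * ((r : ℝ) + 1) ^ 2 * 3 ^ r) := by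
  rw [parkingCol_eq, abs_mul, abs_div, abs_pow, abs_neg, abs_one, one_pow,
    abs_of_nonneg (logTail_nonneg r), abs_of_pos (by positivity : (0 : ℝ) < r + 1)]
  refine (mul_le_mul_of_nonneg_left (logTail_le r) (by positivity)).trans (le_of_eq ?_)
  field_simp

theorem abs_parkingCol_add_le (p r : ℕ) :
    |parkingCol (r + p)| ≤ 1 / (2 * ((p : ℝ) + 1) ^ 2 * 3 ^ p) * (1 / 3 ^ r) := by
  refine (abs_parkingCol_le _).trans ?_
  rw [one_div_mul_one_div]
  apply one_div_le_one_div_of_le (by positivity)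
  rw [pow_add, mul_assoc, mul_comm (3 ^ p : ℝ)]
  gcongr
  linarith [(Nat.cast_nonneg r : (0 : ℝ) ≤ r)]

theorem sum_abs_parkingCol_add_le (p m : ℕ) :
    ∑ r ∈ Finset.range m, |parkingCol (r + p)| ≤
      3 / 2 * (1 / (2 * ((p : ℝ) + 1) ^ 2 * 3 ^ p)) := by
  refine (Finset.sum_le_sum fun r _ => abs_parkingCol_add_le p r).trans ?_
  rw [← Finset.mul_sum, mul_comm]
  refine mul_le_mul_of_nonneg_right ?_ (by positivity)
  have h : Summable fun r : ℕ => (1 / 3 : ℝ) ^ r :=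
    summable_geometric_of_lt_one (by norm_num) (by norm_num)
  calc ∑ r ∈ Finset.range m, 1 / (3 : ℝ) ^ r = ∑ r ∈ Finset.range m, (1 / 3 : ℝ) ^ r := by
        simp_rw [one_div_pow]
    _ ≤ ∑' r : ℕ, (1 / 3 : ℝ) ^ r := h.sum_le_tsum _ fun _ _ => by positivity
    _ = 3 / 2 := by
      rw [tsum_geometric_of_lt_one (by norm_num) (by norm_num)]; norm_num

/-- The constant is `1/2` for the first entry plus `1/16` for the geometric bound on the others. -/
theorem sum_abs_parkingCol_le (m : ℕ) : ∑ r ∈ Finset.range m, |parkingCol r| ≤ 9 / 16 := by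
  cases m with
  | zero => norm_num
  | succ m =>
    rw [Finset.sum_range_succ']
    have h1 := sum_abs_parkingCol_add_le 1 m
    have h2 := abs_parkingCol_le 0
    norm_num at h1 h2 ⊢
    linarith

/-- The weight `3 ^ r` exactly cancels the exponential decay and leaves `1 / (2 (r + 1) ^ 2)`; the
range `ρ ≤ 3` rests on this. -/
theorem summable_pow_mul_abs_parkingCol : Summable fun r => 3 ^ r * |parkingCol r| := by
  have h : Summable fun r : ℕ => (1 / 2 : ℝ) * (1 / (((r + 1 : ℕ) : ℝ) ^ 2)) :=
    ((summable_nat_add_iff 1).2 (Real.summable_one_div_nat_pow.2 one_lt_two)).mul_left _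
  refine Summable.of_nonneg_of_le (fun _ => by positivity) (fun r => ?_) h
  refine (mul_le_mul_of_nonneg_left (abs_parkingCol_le r) (by positivity)).trans (le_of_eq ?_)
  push_cast
  field_simp

/-! ### Numerical bounds for the entries `A_{1,1}` and `A_{1,0}` -/

theorem parkingDiag_eq : parkingDiag = 1 / 2 + Real.log 2 := rfl

theorem parkingDiag_gt : 1193 / 1000 < parkingDiag := by
  rw [parkingDiag_eq]; linarith [Real.log_two_gt_d9]

theorem parkingDiag_lt : parkingDiag < 1194 / 1000 := by
  rw [parkingDiag_eq]; linarith [Real.log_two_lt_d9]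

theorem dilog_term_abs_le (p k : ℕ) :
    |(-1 : ℝ) ^ (k + p + 1) / ((((k + p : ℕ) : ℝ) + 1) ^ 2 * 2 ^ (k + p + 1))| ≤
      1 / (((p : ℝ) + 1) ^ 2 * 2 ^ (p + 1)) * (1 / 2) ^ k := by
  rw [abs_div, abs_pow, abs_neg, abs_one, one_pow, abs_of_pos (by positivity), one_div_pow,
    one_div_mul_one_div]
  apply one_div_le_one_div_of_le (by positivity)
  rw [add_assoc k, pow_add 2 k, mul_assoc, mul_comm ((2 : ℝ) ^ k)]
  gcongr
  linarith [(Nat.cast_nonneg k : (0 : ℝ) ≤ k)]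

theorem abs_dilog_tail_le (p : ℕ) :
    Summable (fun k : ℕ => (-1 : ℝ) ^ (k + p + 1) / ((((k + p : ℕ) : ℝ) + 1) ^ 2 * 2 ^ (k + p + 1)))
    ∧ |∑' k : ℕ, (-1 : ℝ) ^ (k + p + 1) / ((((k + p : ℕ) : ℝ) + 1) ^ 2 * 2 ^ (k + p + 1))| ≤
      1 / (((p : ℝ) + 1) ^ 2 * 2 ^ p) := by
  have hg : Summable fun k : ℕ => 1 / (((p : ℝ) + 1) ^ 2 * 2 ^ (p + 1)) * (1 / 2 : ℝ) ^ k :=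
    summable_geometric_two.mul_left _
  refine ⟨Summable.of_norm_bounded hg (dilog_term_abs_le p), ?_⟩
  rw [← Real.norm_eq_abs]
  refine (tsum_of_norm_bounded hg.hasSum (dilog_term_abs_le p)).trans (le_of_eq ?_)
  rw [tsum_mul_left, tsum_geometric_two]
  field_simp
  ring

theorem parkingCorner_eq : parkingCorner = Real.pi ^ 2 / 12 +
    (∑' k : ℕ, (-1 : ℝ) ^ (k + 1) / (((k : ℝ) + 1) ^ 2 * 2 ^ (k + 1))) - Real.log 2 / 2 := rfl

theorem parkingCorner_lt : parkingCorner < 33 / 1000 := by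
  have h0 := (abs_dilog_tail_le 0).1
  have h3 := (abs_le.1 (abs_dilog_tail_le 3).2).2
  have hs := h0.sum_add_tsum_nat_add 3
  simp only [add_zero] at hs
  have hpi : Real.pi ^ 2 < 3.1416 ^ 2 := by
    have := Real.pi_lt_d4
    have := Real.pi_pos
    gcongr
  rw [parkingCorner_eq, ← hs]
  norm_num [Finset.sum_range_succ] at h3 hpi ⊢
  linarith [Real.log_two_gt_d9]

theorem neg_one_lt_parkingCorner : -1 < parkingCorner := by
  have h0 := (abs_le.1 (abs_dilog_tail_le 0).2).1
  have hpi : (9 : ℝ) < Real.pi ^ 2 := by nlinarith [Real.pi_gt_three]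
  rw [parkingCorner_eq]
  norm_num at h0 ⊢
  linarith [Real.log_two_lt_d9]

/-! ### A priori bounds for the block -/

/-- Weighted `ℓ¹` bound for the resolvent of the block. -/
theorem sum_le_of_le_add_block {L ρ : ℝ} (hρ : 1 ≤ ρ) {m : ℕ} {x z : ℕ → ℝ}
    (hx : ∀ r, 0 ≤ x r)
    (h : ∀ r < m, L * x r ≤ z r + ∑ k ∈ Finset.range m, |parkingBlock r k| * x k) :
    (L - 1 / 2) * ∑ r ∈ Finset.range m, ρ ^ r * x r ≤ ∑ r ∈ Finset.range m, ρ ^ r * z r := by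
  have hρ0 : 0 < ρ := by linarith
  have h1 : ∑ r ∈ Finset.range m, ρ ^ r * (L * x r) ≤ ∑ r ∈ Finset.range m,
      ρ ^ r * (z r + ∑ k ∈ Finset.range m, |parkingBlock r k| * x k) :=
    Finset.sum_le_sum fun r hr =>
      mul_le_mul_of_nonneg_left (h r (Finset.mem_range.1 hr)) (by positivity)
  have h2 : ∑ r ∈ Finset.range m, ρ ^ r * ∑ k ∈ Finset.range m, |parkingBlock r k| * x k ≤
      ∑ k ∈ Finset.range m, 1 / 2 * (ρ ^ k * x k) := by
    simp_rw [Finset.mul_sum]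
    rw [Finset.sum_comm]
    refine Finset.sum_le_sum fun k _ => ?_
    calc ∑ r ∈ Finset.range m, ρ ^ r * (|parkingBlock r k| * x k)
        ≤ ∑ r ∈ Finset.range m, |parkingBlock r k| * (ρ ^ k * x k) := by
          refine Finset.sum_le_sum fun r _ => ?_
          -- Only rows `r ≤ k` occur, and there `ρ ^ r ≤ ρ ^ k`: increasing weights do not enlarge
          -- the norm of an upper triangular matrix.
          rcases le_or_gt r k with hrk | hrk
          · have := pow_le_pow_right₀ hρ hrk
            calc _ = |parkingBlock r k| * (ρ ^ r * x k) := by ring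
              _ ≤ _ := by gcongr; exact hx k
          · rw [parkingBlock_eq_zero hrk]; simp
      _ ≤ _ := by
          rw [← Finset.sum_mul]
          exact mul_le_mul_of_nonneg_right (sum_abs_parkingBlock_le k m)
            (mul_nonneg (by positivity) (hx k))
  simp_rw [mul_add, Finset.sum_add_distrib] at h1
  rw [← Finset.mul_sum] at h2
  have h3 : ∑ r ∈ Finset.range m, ρ ^ r * (L * x r) =
      L * ∑ r ∈ Finset.range m, ρ ^ r * x r := by
    rw [Finset.mul_sum]; exact Finset.sum_congr rfl fun _ _ => by ring
  linarith

/-- `ℓ^∞` bound for the resolvent of the transposed block. -/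
theorem le_of_le_add_block_transpose {L B : ℝ} (hL : 1 / 2 < L) {m : ℕ} {y : ℕ → ℝ}
    (hy : ∀ r, 0 ≤ y r)
    (h : ∀ k < m, L * y k ≤ B + ∑ r ∈ Finset.range m, y r * |parkingBlock r k|)
    {k : ℕ} (hk : k < m) : y k ≤ B / (L - 1 / 2) := by
  -- At an index where `y` is largest, the block sum is at most half of that maximum and can be
  -- absorbed.
  obtain ⟨j, hj, hmax⟩ := Finset.exists_max_image (Finset.range m) y
    ⟨k, Finset.mem_range.2 hk⟩
  refine (hmax k (Finset.mem_range.2 hk)).trans ?_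
  have h1 : ∑ r ∈ Finset.range m, y r * |parkingBlock r j| ≤ y j * (1 / 2) := by
    refine (Finset.sum_le_sum fun r hr =>
      mul_le_mul_of_nonneg_right (hmax r hr) (abs_nonneg _)).trans ?_
    rw [← Finset.mul_sum]
    exact mul_le_mul_of_nonneg_left (sum_abs_parkingBlock_le j m) (hy j)
  rw [le_div_iff₀ (by linarith)]
  linarith [h j (Finset.mem_range.1 hj)]

theorem abs_le_of_eq_add_block_transpose {l B : ℝ} (hl : 1 / 2 < l) {m : ℕ} {y z : ℕ → ℝ}
    (hz : ∀ k, |z k| ≤ B)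
    (h : ∀ k < m, l * y k = z k + ∑ r ∈ Finset.range m, y r * parkingBlock r k)
    {k : ℕ} (hk : k < m) : |y k| ≤ B / (l - 1 / 2) := by
  refine le_of_le_add_block_transpose (y := fun k => |y k|) hl (fun _ => abs_nonneg _)
    (fun k hk => ?_) hk
  rw [← abs_of_pos (show 0 < l by linarith), ← abs_mul, h k hk]
  refine (abs_add_le _ _).trans (add_le_add (hz k) ((Finset.abs_sum_le_sum_abs _ _).trans ?_))
  simp_rw [abs_mul]; rfl

/-- By triangularity, the equation for column `k` is the same in every truncation containing it, so
one sequence solves all of them. -/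
theorem sum_block_column (y : ℕ → ℝ) {k m : ℕ} (hk : k < m) :
    ∑ r ∈ Finset.range m, y r * parkingBlock r k =
      ∑ r ∈ Finset.range (k + 1), y r * parkingBlock r k := by
  refine (Finset.sum_subset (Finset.range_subset_range.2 hk) fun r _ hr => ?_).symm
  rw [parkingBlock_eq_zero (by simpa using hr), mul_zero]

/-! ### The left eigenvector as a function of the eigenvalue -/

/-- The solution `y` of `l y - y T = row`, where `T` is the triangular block. -/
def leftSol (l : ℝ) (k : ℕ) : ℝ :=
  (parkingRow k + ∑ r : Fin k, leftSol l r * parkingBlock r k) / (l - parkingBlock k k)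
termination_by k
decreasing_by exact r.2

theorem leftSol_eq_div (l : ℝ) (k : ℕ) : leftSol l k =
    (parkingRow k + ∑ r ∈ Finset.range k, leftSol l r * parkingBlock r k) /
      (l - parkingBlock k k) := by
  rw [leftSol, Finset.sum_range]

theorem sub_parkingBlock_diag_pos {l : ℝ} (hl : 1 / 2 < l) (k : ℕ) :
    0 < l - parkingBlock k k := by
  linarith [(le_abs_self _).trans (abs_parkingBlock_diag_le k)]

theorem leftSol_equation {l : ℝ} (hl : 1 / 2 < l) {k m : ℕ} (hk : k < m) :
    l * leftSol l k = parkingRow k + ∑ r ∈ Finset.range m, leftSol l r * parkingBlock r k := by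
  rw [sum_block_column _ hk, Finset.sum_range_succ]
  have h := leftSol_eq_div l k
  rw [eq_div_iff (sub_parkingBlock_diag_pos hl k).ne'] at h
  linarith

theorem abs_leftSol_le {l : ℝ} (hl : 1 / 2 < l) (k : ℕ) :
    |leftSol l k| ≤ 1 / 2 / (l - 1 / 2) :=
  abs_le_of_eq_add_block_transpose hl abs_parkingRow_le
    (fun _ hk => leftSol_equation hl hk) k.lt_succ_self

/-- Resolvent identity: the difference solves the system at `l` with source `(l' - l) * leftSol l'`.
-/
theorem abs_leftSol_sub_le {l l' : ℝ} (hl : 1 / 2 < l) (hl' : 1 / 2 < l') (k : ℕ) :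
    |leftSol l k - leftSol l' k| ≤ |l' - l| * (1 / 2 / (l' - 1 / 2)) / (l - 1 / 2) := by
  refine abs_le_of_eq_add_block_transpose (y := fun k => leftSol l k - leftSol l' k)
    (z := fun k => (l' - l) * leftSol l' k) (m := k + 1) hl (fun k => ?_) (fun j hj => ?_)
    k.lt_succ_self
  · rw [abs_mul]
    exact mul_le_mul_of_nonneg_left (abs_leftSol_le hl' k) (abs_nonneg _)
  · simp_rw [sub_mul, Finset.sum_sub_distrib]
    linarith [leftSol_equation hl hj, leftSol_equation hl' hj]

theorem continuousOn_leftSol (k : ℕ) : ContinuousOn (fun l => leftSol l k) (Set.Ioi (1 / 2)) := by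
  induction k using Nat.strong_induction_on with
  | _ k ih =>
    simp_rw [leftSol_eq_div _ k]
    refine ContinuousOn.div (continuousOn_const.add (continuousOn_finsetSum _ fun r hr =>
      (ih r (Finset.mem_range.1 hr)).mul continuousOn_const)) (by fun_prop)
      fun l hl => (sub_parkingBlock_diag_pos hl k).ne'

/-- Uniqueness of the left solution. -/
theorem eq_leftSol {l c : ℝ} (hl : 1 / 2 < l) {m : ℕ} {y : ℕ → ℝ}
    (h : ∀ k < m, l * y k = parkingRow k * c + ∑ r ∈ Finset.range m, y r * parkingBlock r k)
    {k : ℕ} (hk : k < m) : y k = c * leftSol l k := by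
  have h0 := abs_le_of_eq_add_block_transpose (B := 0) (y := fun k => y k - c * leftSol l k)
    (z := fun _ => 0) (m := m) hl (by simp) (fun j hj => by
      simp_rw [sub_mul, Finset.sum_sub_distrib, mul_assoc c, ← Finset.mul_sum]
      linear_combination h j hj - c * leftSol_equation hl hj) hk
  rw [zero_div] at h0
  linarith [abs_nonpos_iff.1 h0]

/-- In the equation for a late column, the source and the finitely many early rows are eventually
below `M / 4`, and the late rows contribute at most `M / 2`. Iteration gives convergence to zero. -/
theorem eventually_abs_leftSol_le {l : ℝ} (hl : 1 ≤ l) {M : ℝ} (hM : 0 < M)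
    (h : ∀ᶠ k in atTop, |leftSol l k| ≤ M) : ∀ᶠ k in atTop, |leftSol l k| ≤ 3 / 4 * M := by
  obtain ⟨K, hK⟩ := eventually_atTop.1 h
  have ht : Tendsto (fun k => |parkingRow k| +
      ∑ r ∈ Finset.range K, |leftSol l r| * |parkingBlock r k|) atTop
      (𝓝 (0 + ∑ r ∈ Finset.range K, |leftSol l r| * 0)) :=
    tendsto_abs_parkingRow.add (tendsto_finsetSum _ fun r _ =>
      (tendsto_parkingBlock_row r).const_mul _)
  simp only [mul_zero, Finset.sum_const_zero, add_zero] at ht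
  filter_upwards [ht.eventually (gt_mem_nhds (show (0 : ℝ) < M / 4 by linarith)),
    eventually_ge_atTop K] with k hk hkK
  have e := leftSol_equation (l := l) (by linarith) k.lt_succ_self
  have h1 : |leftSol l k| ≤ l * |leftSol l k| := le_mul_of_one_le_left (abs_nonneg _) hl
  rw [← abs_of_pos (show 0 < l by linarith), ← abs_mul, abs_of_pos (show 0 < l by linarith), e] at h1
  refine h1.trans ((abs_add_le _ _).trans ?_)
  have h2 : |∑ r ∈ Finset.range (k + 1), leftSol l r * parkingBlock r k| ≤
      ∑ r ∈ Finset.range K, |leftSol l r| * |parkingBlock r k| + M * (1 / 2) := by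
    refine (Finset.abs_sum_le_sum_abs _ _).trans ?_
    simp_rw [abs_mul]
    rw [← Finset.sum_range_add_sum_Ico _ (show K ≤ k + 1 by omega)]
    refine add_le_add le_rfl ?_
    calc ∑ r ∈ Finset.Ico K (k + 1), |leftSol l r| * |parkingBlock r k|
        ≤ ∑ r ∈ Finset.Ico K (k + 1), M * |parkingBlock r k| :=
          Finset.sum_le_sum fun r hr => mul_le_mul_of_nonneg_right
            (hK r (Finset.mem_Ico.1 hr).1) (abs_nonneg _)
      _ ≤ M * (1 / 2) := by
          rw [← Finset.mul_sum]
          refine mul_le_mul_of_nonneg_left ?_ hM.le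
          refine le_trans (Finset.sum_le_sum_of_subset_of_nonneg (fun r hr => ?_)
            fun _ _ _ => abs_nonneg _) (sum_abs_parkingBlock_le k (k + 1))
          exact Finset.mem_range.2 (Finset.mem_Ico.1 hr).2
  linarith

theorem tendsto_leftSol {l : ℝ} (hl : 1 ≤ l) : Tendsto (leftSol l) atTop (𝓝 0) := by
  have hp : ∀ j : ℕ, ∀ᶠ k in atTop, |leftSol l k| ≤ (3 / 4) ^ j * (1 / 2 / (l - 1 / 2)) := by
    intro j
    induction j with
    | zero =>
      refine Eventually.of_forall fun k => ?_
      rw [pow_zero, one_mul]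
      exact abs_leftSol_le (by linarith) k
    | succ j ih =>
      have h2 : 0 < l - 1 / 2 := by linarith
      filter_upwards [eventually_abs_leftSol_le hl (by positivity) ih] with k hk
      rw [pow_succ]; linarith
  have ht : Tendsto (fun j : ℕ => (3 / 4 : ℝ) ^ j * (1 / 2 / (l - 1 / 2))) atTop (𝓝 0) := by
    simpa using (tendsto_pow_atTop_nhds_zero_of_lt_one (r := (3 / 4 : ℝ))
      (by norm_num) (by norm_num)).mul_const (1 / 2 / (l - 1 / 2))
  rw [Metric.tendsto_atTop']
  intro ε hε
  obtain ⟨j, hj⟩ := (ht.eventually (gt_mem_nhds hε)).exists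
  obtain ⟨N, hN⟩ := eventually_atTop.1 (hp j)
  exact ⟨N, fun k hk => by simpa using (hN k hk.le).trans_lt hj⟩

/-! ### The characteristic function -/

/-- The Schur complement whose zeros beyond `1 / 2` are eigenvalues of the truncations. -/
def charFun (m : ℕ) (l : ℝ) : ℝ :=
  (l - 1 / 2) * (l - parkingDiag) + parkingCorner +
    ∑ r ∈ Finset.range m, leftSol l r * parkingCol r

theorem continuousOn_charFun (m : ℕ) : ContinuousOn (charFun m) (Set.Ioi (1 / 2)) := by
  unfold charFun
  refine ContinuousOn.add (by fun_prop) (continuousOn_finsetSum _ fun r _ =>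
    (continuousOn_leftSol r).mul continuousOn_const)

theorem abs_sum_leftSol_mul_le {l : ℝ} (hl : 1 / 2 < l) (s : Finset ℕ) (e : ℕ → ℕ) :
    |∑ r ∈ s, leftSol l (e r) * parkingCol (e r)| ≤
      1 / 2 / (l - 1 / 2) * ∑ r ∈ s, |parkingCol (e r)| := by
  rw [Finset.mul_sum]
  refine (Finset.abs_sum_le_sum_abs _ _).trans (Finset.sum_le_sum fun r _ => ?_)
  rw [abs_mul]
  exact mul_le_mul_of_nonneg_right (abs_leftSol_le hl _) (abs_nonneg _)

theorem charFun_two_pos (m : ℕ) : 0 < charFun m 2 := by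
  have h := (abs_le.1 (abs_sum_leftSol_mul_le (l := 2) (by norm_num) (Finset.range m) id)).1
  have h2 := sum_abs_parkingCol_le m
  unfold charFun
  simp only [id] at h
  norm_num at h ⊢
  linarith [parkingDiag_lt, neg_one_lt_parkingCorner]

theorem leftSol_zero_six_fifths : leftSol (6 / 5) 0 = 5 / 29 := by
  rw [leftSol_eq_div, parkingRow_eq, parkingBlock_eq]; norm_num

theorem leftSol_one_six_fifths : leftSol (6 / 5) 1 = 10 / 29 := by
  rw [leftSol_eq_div, Finset.sum_range_one, leftSol_zero_six_fifths, parkingRow_eq,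
    parkingBlock_eq, parkingBlock_eq]
  norm_num [Nat.choose]

/-- The negative term `leftSol (6/5) 0 * parkingCol 0`, about `-0.069`, outweighs the rest. The
margin is small, so two terms are computed separately and only the tail from `2` on is estimated
crudely; hence the block size `m + 2`. -/
theorem charFun_six_fifths_neg (m : ℕ) : charFun (m + 2) (6 / 5) < 0 := by
  have h := (abs_le.1 (abs_sum_leftSol_mul_le (l := 6 / 5) (by norm_num) (Finset.range m)
    (fun r => r + 2))).2
  have h2 := sum_abs_parkingCol_add_le 2 m
  have c0 : parkingCol 0 ≤ -(65 / 162) := by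
    rw [parkingCol_eq]; have := le_logTail_zero; norm_num; linarith
  have c1 := (le_abs_self _).trans (abs_parkingCol_le 1)
  unfold charFun
  rw [Finset.sum_range_succ', Finset.sum_range_succ', zero_add, leftSol_zero_six_fifths,
    leftSol_one_six_fifths]
  norm_num [add_assoc] at h h2 c1 ⊢
  linarith [parkingDiag_gt, parkingCorner_lt]

theorem exists_charFun_eq_zero (m : ℕ) :
    ∃ l : ℝ, 6 / 5 ≤ l ∧ l ≤ 2 ∧ charFun (m + 2) l = 0 := by
  have hc : ContinuousOn (charFun (m + 2)) (Set.Icc (6 / 5) 2) :=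
    (continuousOn_charFun _).mono fun l hl => lt_of_lt_of_le (by norm_num) hl.1
  obtain ⟨l, hl, h0⟩ := intermediate_value_Icc (by norm_num) hc
    ⟨(charFun_six_fifths_neg m).le, (charFun_two_pos _).le⟩
  exact ⟨l, hl.1, hl.2, h0⟩

/-! ### Eigenvectors of the truncations -/

/-- A finite complex vector, padded by zeroes. -/
def padZeroComplex {m : ℕ} (x : Fin m → ℂ) (i : ℕ) : ℂ :=
  if h : i < m then x ⟨i, h⟩ else 0

theorem padZeroComplex_ofReal {m : ℕ} (x : Fin m → ℝ) (i : ℕ) :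
    padZeroComplex (fun j => (x j : ℂ)) i = (padZero x i : ℂ) := by
  unfold padZeroComplex padZero; split_ifs <;> simp

theorem padZero_val {m : ℕ} (x : Fin m → ℝ) (i : Fin m) : padZero x i = x i := by
  simp [padZero]

theorem padZero_of_lt {m i : ℕ} (x : Fin m → ℝ) (h : i < m) : padZero x i = x ⟨i, h⟩ := by
  simp [padZero, h]

theorem padZero_of_le {m i : ℕ} (x : Fin m → ℝ) (h : m ≤ i) : padZero x i = 0 := by
  simp [padZero, Nat.not_lt.2 h]

/-- The equations for a right eigenvector of the truncation with block of size `m`. -/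
structure IsRightSystem (m : ℕ) (lam x₀ x₁ : ℂ) (x : ℕ → ℂ) : Prop where
  zero : lam * x₀ = x₀ / 2 - x₁
  one : lam * x₁ = parkingCorner * x₀ + parkingDiag * x₁ +
    ∑ k ∈ Finset.range m, parkingRow k * x k
  block : ∀ r < m, lam * x r = parkingCol r * x₀ +
    ∑ k ∈ Finset.range m, parkingBlock r k * x k

theorem sum_range_add_two {M : Type*} [AddCommMonoid M] (f : ℕ → M) (m : ℕ) :
    ∑ i ∈ Finset.range (m + 2), f i = f 0 + f 1 + ∑ i ∈ Finset.range m, f (i + 2) := by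
  rw [Finset.sum_range_succ', Finset.sum_range_succ']; simp only [zero_add]; ac_rfl

theorem isRightSystem_of_mulVec {m : ℕ} {lam : ℂ} {v : Fin (m + 2) → ℂ}
    (h : Matrix.mulVec ((parkingTrunc (m + 1)).map (algebraMap ℝ ℂ)) v = lam • v) :
    IsRightSystem m lam (padZeroComplex v 0) (padZeroComplex v 1)
      (fun r => padZeroComplex v (r + 2)) := by
  have key : ∀ i < m + 2, lam * padZeroComplex v i =
      (parkingMatrix i 0 : ℂ) * padZeroComplex v 0 + (parkingMatrix i 1 : ℂ) * padZeroComplex v 1 +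
        ∑ k ∈ Finset.range m, (parkingMatrix i (k + 2) : ℂ) * padZeroComplex v (k + 2) := by
    intro i hi
    rw [← sum_range_add_two (fun j => (parkingMatrix i j : ℂ) * padZeroComplex v j),
      Finset.sum_range]
    have := congrFun h ⟨i, hi⟩
    simp only [Matrix.mulVec, dotProduct, Pi.smul_apply, smul_eq_mul] at this
    simpa [padZeroComplex, hi, parkingTrunc] using this.symm
  refine ⟨?_, ?_, fun r hr => ?_⟩
  · have := key 0 (by omega)
    simp only [parkingMatrix] at this
    rw [this]; push_cast; simp; ring
  · exact key 1 (by omega)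
  · have := key (r + 2) (by omega)
    rw [show parkingMatrix (r + 2) 1 = 0 from rfl] at this
    simpa [parkingCol, parkingBlock] using this

theorem isRightSystem_of_mulVec_real {m : ℕ} {lam : ℝ} {v : Fin (m + 2) → ℝ}
    (h : Matrix.mulVec (parkingTrunc (m + 1)) v = lam • v) :
    IsRightSystem m lam (padZero v 0) (padZero v 1) (fun r => (padZero v (r + 2) : ℂ)) := by
  have h' : Matrix.mulVec ((parkingTrunc (m + 1)).map (algebraMap ℝ ℂ)) (fun j => (v j : ℂ)) =
      (lam : ℂ) • fun j => (v j : ℂ) := by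
    funext i
    have := RingHom.map_mulVec (algebraMap ℝ ℂ) (parkingTrunc (m + 1)) v i
    rw [h] at this
    simpa [Function.comp_def] using this.symm
  simpa only [padZeroComplex_ofReal] using isRightSystem_of_mulVec h'

theorem vecMul_eq_smul_iff {m : ℕ} {lam : ℝ} {w : Fin (m + 2) → ℝ} :
    Matrix.vecMul w (parkingTrunc (m + 1)) = lam • w ↔
      lam * padZero w 0 = padZero w 0 / 2 + padZero w 1 * parkingCorner +
        ∑ r ∈ Finset.range m, padZero w (r + 2) * parkingCol r ∧
      lam * padZero w 1 = -padZero w 0 + padZero w 1 * parkingDiag ∧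
      ∀ k < m, lam * padZero w (k + 2) = parkingRow k * padZero w 1 +
        ∑ r ∈ Finset.range m, padZero w (r + 2) * parkingBlock r k := by
  have key : ∀ j (hj : j < m + 2), Matrix.vecMul w (parkingTrunc (m + 1)) ⟨j, hj⟩ =
      padZero w 0 * parkingMatrix 0 j + padZero w 1 * parkingMatrix 1 j +
        ∑ r ∈ Finset.range m, padZero w (r + 2) * parkingMatrix (r + 2) j := by
    intro j hj
    rw [← sum_range_add_two (fun i => padZero w i * parkingMatrix i j), Finset.sum_range]
    simp only [Matrix.vecMul, dotProduct, padZero_val, parkingTrunc, Matrix.of_apply]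
  have e0 : ∀ j (hj : j < m + 2), (lam • w) ⟨j, hj⟩ = lam * padZero w j := by
    intro j hj; simp [padZero, hj]
  have c1 : ∑ r ∈ Finset.range m, padZero w (r + 2) * parkingMatrix (r + 2) 1 = 0 :=
    Finset.sum_eq_zero fun r _ => by simp [parkingMatrix]
  constructor
  · intro h
    have h' : ∀ j (hj : j < m + 2), _ := fun j hj =>
      (e0 j hj).symm.trans ((congrFun h ⟨j, hj⟩).symm.trans (key j hj))
    refine ⟨?_, ?_, fun k hk => ?_⟩
    · rw [h' 0 (by omega), show parkingMatrix 0 0 = 1 / 2 from rfl, mul_one_div]; rfl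
    · rw [h' 1 (by omega), c1, show parkingMatrix 0 1 = -1 from rfl, mul_neg_one, add_zero]; rfl
    · rw [h' (k + 2) (by omega), show parkingMatrix 0 (k + 2) = 0 from rfl, mul_zero, zero_add,
        mul_comm (padZero w 1)]; rfl
  · rintro ⟨h0, h1, h2⟩
    funext ⟨j, hj⟩
    rw [key, e0]
    match j, hj with
    | 0, _ => rw [h0, show parkingMatrix 0 0 = 1 / 2 from rfl, mul_one_div]; rfl
    | 1, _ => rw [h1, c1, show parkingMatrix 0 1 = -1 from rfl, mul_neg_one, add_zero]; rfl
    | k + 2, hj =>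
      rw [h2 k (by omega), show parkingMatrix 0 (k + 2) = 0 from rfl, mul_zero, zero_add,
        mul_comm (parkingRow k)]; rfl

/-- Resolvent bound for the block in the weighted `ℓ¹` norm. -/
theorem sum_norm_le_of_block {lam : ℂ} {ρ : ℝ} (hρ : 1 ≤ ρ) {m : ℕ} {x z : ℕ → ℂ}
    (h : ∀ r < m, lam * x r = z r + ∑ k ∈ Finset.range m, parkingBlock r k * x k) :
    (‖lam‖ - 1 / 2) * ∑ r ∈ Finset.range m, ρ ^ r * ‖x r‖ ≤
      ∑ r ∈ Finset.range m, ρ ^ r * ‖z r‖ := by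
  refine sum_le_of_le_add_block hρ (fun _ => norm_nonneg _) fun r hr => ?_
  rw [← norm_mul, h r hr]
  refine (norm_add_le _ _).trans (add_le_add le_rfl ((norm_sum_le _ _).trans ?_))
  simp_rw [norm_mul, Complex.norm_real, Real.norm_eq_abs]; rfl

namespace IsRightSystem

variable {m : ℕ} {lam x₀ x₁ : ℂ} {x : ℕ → ℂ}

theorem one_eq (h : IsRightSystem m lam x₀ x₁ x) : x₁ = (1 / 2 - lam) * x₀ := by
  linear_combination h.zero

theorem sum_norm_le (h : IsRightSystem m lam x₀ x₁ x) {ρ : ℝ} (hρ : 1 ≤ ρ) :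
    (‖lam‖ - 1 / 2) * ∑ r ∈ Finset.range m, ρ ^ r * ‖x r‖ ≤
      ‖x₀‖ * ∑ r ∈ Finset.range m, ρ ^ r * |parkingCol r| := by
  refine (sum_norm_le_of_block hρ h.block).trans (le_of_eq ?_)
  rw [Finset.mul_sum]
  refine Finset.sum_congr rfl fun r _ => ?_
  rw [norm_mul, Complex.norm_real, Real.norm_eq_abs]; ring

theorem eq_zero (h : IsRightSystem m lam 0 x₁ x) (hl : 1 / 2 < ‖lam‖) {r : ℕ} (hr : r < m) :
    x r = 0 := by
  have h1 := h.sum_norm_le (ρ := 1) le_rfl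
  rw [norm_zero, zero_mul] at h1
  have h2 := nonpos_of_mul_nonpos_right h1 (by linarith : 0 < ‖lam‖ - 1 / 2)
  have h3 := Finset.single_le_sum (f := fun r => (1 : ℝ) ^ r * ‖x r‖)
    (fun _ _ => by positivity) (Finset.mem_range.2 hr)
  simp only [one_pow, one_mul] at h2 h3
  exact norm_le_zero_iff.1 (h3.trans h2)

theorem smul (h : IsRightSystem m lam x₀ x₁ x) (t : ℂ) :
    IsRightSystem m lam (t * x₀) (t * x₁) (fun r => t * x r) := by
  refine ⟨by linear_combination t * h.zero, ?_, fun r hr => ?_⟩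
  · simp_rw [mul_left_comm _ t, ← Finset.mul_sum]
    linear_combination t * h.one
  · simp_rw [mul_left_comm _ t, ← Finset.mul_sum]
    linear_combination t * h.block r hr

/-- Pairing a right eigenvector of a truncation with a left eigenvector of a larger one. -/
theorem pairing (h : IsRightSystem m lam 1 x₁ x) {m' : ℕ} (hm : m ≤ m') {mu : ℝ}
    (hmu : 1 / 2 < mu) (h0 : charFun m' mu = 0) :
    (lam - mu) * (lam + mu - parkingDiag - 1 / 2 -
      ∑ r ∈ Finset.range m, (leftSol mu r : ℂ) * x r) =
      ∑ r ∈ Finset.Ico m m', (leftSol mu r : ℂ) * parkingCol r := by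
  -- Evaluate `y·(lam x)` through the right system, then move `T` onto `y` through the left one. The
  -- left root belongs to size `m'`, so the entries of column `0` from `m` to `m'` remain.
  have e1 : lam * ∑ r ∈ Finset.range m, (leftSol mu r : ℂ) * x r =
      ∑ r ∈ Finset.range m, (leftSol mu r : ℂ) * parkingCol r +
      ∑ k ∈ Finset.range m, (mu * leftSol mu k - parkingRow k) * x k := by
    calc lam * ∑ r ∈ Finset.range m, (leftSol mu r : ℂ) * x r
        = ∑ r ∈ Finset.range m, (leftSol mu r : ℂ) * (lam * x r) := by
          rw [Finset.mul_sum]; exact Finset.sum_congr rfl fun _ _ => by ring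
      _ = ∑ r ∈ Finset.range m, ((leftSol mu r : ℂ) * parkingCol r +
            ∑ k ∈ Finset.range m, (leftSol mu r : ℂ) * parkingBlock r k * x k) := by
          refine Finset.sum_congr rfl fun r hr => ?_
          rw [h.block r (Finset.mem_range.1 hr), mul_add, Finset.mul_sum, mul_one]
          simp_rw [mul_assoc]
      _ = _ := by
          rw [Finset.sum_add_distrib, Finset.sum_comm]
          congr 1
          refine Finset.sum_congr rfl fun k hk => ?_
          rw [← Finset.sum_mul]
          congr 1
          have := leftSol_equation hmu (Finset.mem_range.1 hk)
          rw [← Complex.ofReal_mul, this]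
          push_cast; ring
  have e2 : ∑ k ∈ Finset.range m, (mu * leftSol mu k - parkingRow k) * x k =
      mu * ∑ r ∈ Finset.range m, (leftSol mu r : ℂ) * x r -
        ∑ k ∈ Finset.range m, parkingRow k * x k := by
    rw [Finset.mul_sum, ← Finset.sum_sub_distrib]
    exact Finset.sum_congr rfl fun _ _ => by ring
  have e3 : ((mu : ℂ) - 1 / 2) * (mu - parkingDiag) + parkingCorner +
      ∑ r ∈ Finset.range m', (leftSol mu r : ℂ) * parkingCol r = 0 := by
    unfold charFun at h0
    have := congrArg Complex.ofReal h0
    push_cast at this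
    exact this
  rw [← Finset.sum_range_add_sum_Ico _ hm] at e3
  have e4 := h.one
  rw [h.one_eq] at e4
  linear_combination -e1 - e2 - e3 - e4

/-- The term `lam` dominates: `6/5 - 1/2 - (5/7) * (45/56) > 1/10`. Here `5/7 = (1/2) / (7/10)`
bounds `leftSol`, and `45/56 = (9/16) / (7/10)` bounds the `ℓ¹` norm of `x`. -/
theorem norm_pairing_factor_ge (h : IsRightSystem m lam 1 x₁ x) (hl : 6 / 5 ≤ ‖lam‖)
    {mu : ℝ} (hmu : 6 / 5 ≤ mu) (hmu2 : mu ≤ 2) :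
    1 / 10 ≤ ‖lam + mu - parkingDiag - 1 / 2 -
      ∑ r ∈ Finset.range m, (leftSol mu r : ℂ) * x r‖ := by
  have h1 := h.sum_norm_le (ρ := 1) le_rfl
  simp only [norm_one, one_pow, one_mul] at h1
  have h2 := sum_abs_parkingCol_le m
  set S := ∑ r ∈ Finset.range m, ‖x r‖
  have hS0 : 0 ≤ S := Finset.sum_nonneg fun _ _ => norm_nonneg _
  have hS : S ≤ 45 / 56 := by nlinarith
  have h3 : ‖∑ r ∈ Finset.range m, (leftSol mu r : ℂ) * x r‖ ≤ 5 / 7 * S := by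
    rw [Finset.mul_sum]
    refine (norm_sum_le _ _).trans (Finset.sum_le_sum fun r _ => ?_)
    rw [norm_mul, Complex.norm_real, Real.norm_eq_abs]
    refine mul_le_mul_of_nonneg_right ((abs_leftSol_le (by linarith) r).trans ?_) (norm_nonneg _)
    rw [div_le_iff₀ (by linarith)]; linarith
  have h4 : ‖((mu - parkingDiag - 1 / 2 : ℝ) : ℂ)‖ ≤ 1 / 2 := by
    rw [Complex.norm_real, Real.norm_eq_abs, abs_le]
    constructor <;> linarith [parkingDiag_gt, parkingDiag_lt]
  have h5 : lam = (lam + mu - parkingDiag - 1 / 2 -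
      ∑ r ∈ Finset.range m, (leftSol mu r : ℂ) * x r) - ((mu - parkingDiag - 1 / 2 : ℝ) : ℂ) +
      ∑ r ∈ Finset.range m, (leftSol mu r : ℂ) * x r := by push_cast; ring
  have h6 := congrArg norm h5
  have h7 := (norm_add_le (lam + mu - parkingDiag - 1 / 2 -
      ∑ r ∈ Finset.range m, (leftSol mu r : ℂ) * x r - ((mu - parkingDiag - 1 / 2 : ℝ) : ℂ))
      (∑ r ∈ Finset.range m, (leftSol mu r : ℂ) * x r))
  have h8 := norm_sub_le (lam + mu - parkingDiag - 1 / 2 -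
      ∑ r ∈ Finset.range m, (leftSol mu r : ℂ) * x r) ((mu - parkingDiag - 1 / 2 : ℝ) : ℂ)
  linarith

end IsRightSystem

/-- The left eigenvector, as a sequence, normalized at index `1`. -/
def leftVec (l : ℝ) : ℕ → ℝ
  | 0 => parkingDiag - l
  | 1 => 1
  | k + 2 => leftSol l k

theorem vecMul_leftVec {m : ℕ} {mu : ℝ} (hmu : 1 / 2 < mu) (h0 : charFun m mu = 0) :
    Matrix.vecMul (fun i : Fin (m + 2) => leftVec mu i) (parkingTrunc (m + 1)) =
      mu • fun i : Fin (m + 2) => leftVec mu i := by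
  have e : ∀ i < m + 2, padZero (fun i : Fin (m + 2) => leftVec mu i) i = leftVec mu i :=
    fun i hi => by simp [padZero, hi]
  have es : ∀ f : ℕ → ℝ, ∑ r ∈ Finset.range m,
      padZero (fun i : Fin (m + 2) => leftVec mu i) (r + 2) * f r =
      ∑ r ∈ Finset.range m, leftSol mu r * f r := fun f =>
    Finset.sum_congr rfl fun r hr => by
      rw [e _ (by have := Finset.mem_range.1 hr; omega)]; rfl
  rw [vecMul_eq_smul_iff, e 0 (by omega), e 1 (by omega)]
  simp only [es]
  rw [show leftVec mu 0 = parkingDiag - mu from rfl, show leftVec mu 1 = 1 from rfl]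
  unfold charFun at h0
  refine ⟨by linarith, by ring, fun k hk => ?_⟩
  rw [e _ (by omega), mul_one]
  exact leftSol_equation hmu hk

theorem eq_leftVec {m : ℕ} {mu : ℝ} (hmu : 1 / 2 < mu) {w : Fin (m + 2) → ℝ}
    (h : Matrix.vecMul w (parkingTrunc (m + 1)) = mu • w) (i : Fin (m + 2)) :
    w i = padZero w 1 * leftVec mu i := by
  obtain ⟨-, h1, h2⟩ := vecMul_eq_smul_iff.1 h
  rw [← padZero_val w i]
  obtain ⟨i, hi⟩ := i
  match i, hi with
  | 0, _ => simp only [leftVec]; linarith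
  | 1, _ => simp [leftVec]
  | k + 2, hk => exact eq_leftSol (y := fun k => padZero w (k + 2)) hmu h2 (by omega)

theorem eq_zero_of_padZeroComplex {m : ℕ} {lam : ℂ} (hl : 1 / 2 < ‖lam‖) {v : Fin (m + 2) → ℂ}
    (h : Matrix.mulVec ((parkingTrunc (m + 1)).map (algebraMap ℝ ℂ)) v = lam • v)
    (h0 : padZeroComplex v 0 = 0) : v = 0 := by
  have hs := isRightSystem_of_mulVec h
  rw [h0] at hs
  have h1 := hs.one_eq
  rw [mul_zero] at h1
  funext ⟨i, hi⟩
  have : padZeroComplex v i = 0 := by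
    match i, hi with
    | 0, _ => exact h0
    | 1, _ => exact h1
    | k + 2, hk => exact hs.eq_zero hl (r := k) (by omega)
  simpa [padZeroComplex, hi] using this

theorem eq_zero_of_padZero {m : ℕ} {lam : ℝ} (hl : 1 / 2 < lam) {v : Fin (m + 2) → ℝ}
    (h : Matrix.mulVec (parkingTrunc (m + 1)) v = lam • v) (h0 : padZero v 0 = 0) : v = 0 := by
  have hs := isRightSystem_of_mulVec_real h
  have hl' : 1 / 2 < ‖(lam : ℂ)‖ := by
    rw [Complex.norm_real, Real.norm_eq_abs]; exact hl.trans_le (le_abs_self _)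
  rw [h0, Complex.ofReal_zero] at hs
  have h1 := hs.one_eq
  rw [mul_zero] at h1
  funext ⟨i, hi⟩
  have : padZero v i = 0 := by
    match i, hi with
    | 0, _ => exact h0
    | 1, _ => exact_mod_cast h1
    | k + 2, hk => exact_mod_cast hs.eq_zero hl' (r := k) (by omega)
  simpa [padZero, hi] using this

theorem padZero_one_eq {m : ℕ} {lam : ℝ} {v : Fin (m + 2) → ℝ}
    (h : Matrix.mulVec (parkingTrunc (m + 1)) v = lam • v) :
    padZero v 1 = (1 / 2 - lam) * padZero v 0 := by
  apply Complex.ofReal_injective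
  push_cast
  exact (isRightSystem_of_mulVec_real h).one_eq

/-! ### Existence and uniqueness of the maximum eigentriple -/

theorem exists_right_eigenvector {m : ℕ} {mu : ℝ} (hmu : 1 / 2 < mu) (h0 : charFun m mu = 0) :
    ∃ v : Fin (m + 2) → ℝ, Matrix.mulVec (parkingTrunc (m + 1)) v = mu • v ∧ v ≠ 0 := by
  have hl : ∃ w ≠ 0, Matrix.vecMul w
      (parkingTrunc (m + 1) - mu • (1 : Matrix (Fin (m + 2)) (Fin (m + 2)) ℝ)) = 0 := by
    refine ⟨fun i => leftVec mu i, fun h => ?_, ?_⟩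
    · have := congrFun h ⟨1, by omega⟩
      simp [leftVec] at this
    · rw [Matrix.vecMul_sub, vecMul_leftVec hmu h0, Matrix.vecMul_smul, Matrix.vecMul_one, sub_self]
  -- Left and right kernels are nontrivial together, both being detected by the determinant.
  rw [Matrix.exists_vecMul_eq_zero_iff, ← Matrix.exists_mulVec_eq_zero_iff] at hl
  obtain ⟨v, hv, h⟩ := hl
  refine ⟨v, ?_, hv⟩
  rwa [Matrix.sub_mulVec, Matrix.smul_mulVec, Matrix.one_mulVec, sub_eq_zero] at h

theorem isMaxEigenvalue_of_charFun {m : ℕ} {mu : ℝ} (hmu : 6 / 5 ≤ mu) (hmu2 : mu ≤ 2)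
    (h0 : charFun m mu = 0) : IsMaxEigenvalue (parkingTrunc (m + 1)) mu := by
  constructor
  · obtain ⟨v, hv, hne⟩ := exists_right_eigenvector (by linarith) h0
    refine Module.End.hasEigenvalue_of_hasEigenvector (x := fun j => (v j : ℂ))
      ⟨Module.End.mem_eigenspace_iff.2 ?_, fun h => hne ?_⟩
    · funext i
      have := RingHom.map_mulVec (algebraMap ℝ ℂ) (parkingTrunc (m + 1)) v i
      rw [hv] at this
      simpa [Function.comp_def] using this.symm
    · funext i
      exact Complex.ofReal_eq_zero.1 (congrFun h i)
  · intro lam hlam hne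
    by_contra hlt
    have hl : 6 / 5 ≤ ‖lam‖ := by linarith
    obtain ⟨v, hv⟩ := hlam.exists_hasEigenvector
    have hv1 : Matrix.mulVec ((parkingTrunc (m + 1)).map (algebraMap ℝ ℂ)) v = lam • v :=
      Module.End.mem_eigenspace_iff.1 hv.1
    have hv0 : padZeroComplex v 0 ≠ 0 := fun h =>
      hv.2 (eq_zero_of_padZeroComplex (by linarith) hv1 h)
    have hs := (isRightSystem_of_mulVec hv1).smul (padZeroComplex v 0)⁻¹
    rw [inv_mul_cancel₀ hv0] at hs
    have hp := hs.pairing le_rfl (by linarith) h0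
    rw [Finset.Ico_self, Finset.sum_empty] at hp
    rcases mul_eq_zero.1 hp with h | h
    · exact hne (sub_eq_zero.1 h)
    · have := hs.norm_pairing_factor_ge hl hmu hmu2
      rw [h, norm_zero] at this
      norm_num at this

theorem IsMaxEigenvalue.unique {m : ℕ} {B : Matrix (Fin m) (Fin m) ℝ} {l l' : ℝ}
    (h : IsMaxEigenvalue B l) (h' : IsMaxEigenvalue B l') : l = l' := by
  by_contra hne
  have h1 := h.2 _ h'.1 (fun e => hne (Complex.ofReal_injective e).symm)
  have h2 := h'.2 _ h.1 (fun e => hne (Complex.ofReal_injective e))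
  rw [Complex.norm_real, Real.norm_eq_abs] at h1 h2
  linarith [le_abs_self l, le_abs_self l']

/-- Maximum eigenvalues are unique, so any of them is the root supplied by the sign change and
inherits its bounds. -/
theorem IsMaxEigenvalue.charFun_eq_zero {m : ℕ} {l : ℝ}
    (h : IsMaxEigenvalue (parkingTrunc (m + 3)) l) :
    6 / 5 ≤ l ∧ l ≤ 2 ∧ charFun (m + 2) l = 0 := by
  obtain ⟨mu, h1, h2, h3⟩ := exists_charFun_eq_zero m
  rw [h.unique (isMaxEigenvalue_of_charFun h1 h2 h3)]
  exact ⟨h1, h2, h3⟩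

/-- The entry with index `0` of the normalized right eigenvector. -/
def rightScale (c : ℕ) (l : ℝ) : ℝ := if c = 0 then 1 else (1 / 2 - l)⁻¹

/-- The entry with index `1` of the normalized left eigenvector. -/
def leftScale (c : ℕ) (l : ℝ) : ℝ := if c = 0 then (parkingDiag - l)⁻¹ else 1

theorem padZero_zero_eq_rightScale {m c : ℕ} (hc : c = 0 ∨ c = 1) {l : ℝ}
    {v : Fin (m + 2) → ℝ} (h : Matrix.mulVec (parkingTrunc (m + 1)) v = l • v)
    (h1 : padZero v c = 1) : padZero v 0 = rightScale c l := by
  rcases hc with rfl | rfl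
  · simpa [rightScale] using h1
  · rw [padZero_one_eq h] at h1
    simpa [rightScale] using eq_inv_of_mul_eq_one_right h1

theorem padZero_one_eq_leftScale {m c : ℕ} (hc : c = 0 ∨ c = 1) {l : ℝ}
    {w : Fin (m + 2) → ℝ} (h : Matrix.vecMul w (parkingTrunc (m + 1)) = l • w)
    (h1 : padZero w c = 1) : padZero w 1 = leftScale c l := by
  rcases hc with rfl | rfl
  · have h2 : (parkingDiag - l) * padZero w 1 = 1 := by
      rw [← h1]; linarith [(vecMul_eq_smul_iff.1 h).2.1]
    simpa [leftScale] using eq_inv_of_mul_eq_one_right h2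
  · simpa [leftScale] using h1

theorem existsUnique_isMaxEigentriple {c : ℕ} (hc : c = 0 ∨ c = 1) (m : ℕ) :
    ∃! t : ℝ × (Fin (m + 3 + 1) → ℝ) × (Fin (m + 3 + 1) → ℝ),
      IsMaxEigentriple (m + 3) c t.1 t.2.1 t.2.2 := by
  obtain ⟨mu, h1, h2, h3⟩ := exists_charFun_eq_zero m
  have hmax := isMaxEigenvalue_of_charFun h1 h2 h3
  have hhalf : 1 / 2 < mu := by linarith
  have hpad : ∀ (t : ℝ) (x : Fin (m + 3 + 1) → ℝ) i, padZero (t • x) i = t * padZero x i := by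
    intro t x i; unfold padZero; split_ifs <;> simp
  obtain ⟨v, hv, hvne⟩ := exists_right_eigenvector hhalf h3
  have hw := vecMul_leftVec hhalf h3
  set w : Fin (m + 2 + 2) → ℝ := fun i => leftVec mu i with hwdef
  have hvc : padZero v c ≠ 0 := by
    have hv0 : padZero v 0 ≠ 0 := fun h => hvne (eq_zero_of_padZero hhalf hv h)
    rcases hc with rfl | rfl
    · exact hv0
    · rw [padZero_one_eq hv]; exact mul_ne_zero (by linarith) hv0
  have hwc : padZero w c ≠ 0 := by
    rcases hc with rfl | rfl
    -- The entry `w_0 = parkingDiag - mu` is nonzero because `parkingDiag < 1.194 < 6/5 ≤ mu`.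
    · have := parkingDiag_lt
      simp only [padZero, hwdef, leftVec]
      simp; linarith
    · simp [padZero, hwdef, leftVec]
  refine ⟨(mu, (padZero v c)⁻¹ • v, (padZero w c)⁻¹ • w), ⟨hmax, ?_, ?_, ?_, ?_⟩, ?_⟩
  · simp only
    rw [Matrix.mulVec_smul, hv, smul_comm]
  · simp only
    rw [Matrix.smul_vecMul, hw, smul_comm]
  · simp only [hpad]; exact inv_mul_cancel₀ hvc
  · simp only [hpad]; exact inv_mul_cancel₀ hwc
  · rintro ⟨l, v', w'⟩ ⟨hm', hv', hw', hvn, hwn⟩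
    simp only at hm' hv' hw' hvn hwn
    obtain rfl := hm'.unique hmax
    have ev : v' = (padZero v c)⁻¹ • v := by
      have hsub : Matrix.mulVec (parkingTrunc (m + 3)) (v' - (padZero v c)⁻¹ • v) =
          l • (v' - (padZero v c)⁻¹ • v) := by
        rw [Matrix.mulVec_sub, Matrix.mulVec_smul, hv, hv', smul_sub, smul_comm]
      refine sub_eq_zero.1 (eq_zero_of_padZero (m := m + 2) hhalf hsub ?_)
      have a1 := padZero_zero_eq_rightScale (m := m + 2) hc hv' hvn
      have a2 := padZero_zero_eq_rightScale (m := m + 2) hc (v := (padZero v c)⁻¹ • v) (l := l)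
        (by rw [Matrix.mulVec_smul, hv, smul_comm])
        (by rw [hpad]; exact inv_mul_cancel₀ hvc)
      rw [padZero_of_lt _ (by omega)] at a1 a2 ⊢
      rw [Pi.sub_apply, a1, a2, sub_self]
    have ew : w' = (padZero w c)⁻¹ • w := by
      have b2 : Matrix.vecMul ((padZero w c)⁻¹ • w) (parkingTrunc (m + 3)) =
          l • (padZero w c)⁻¹ • w := by rw [Matrix.smul_vecMul, hw, smul_comm]
      funext i
      rw [eq_leftVec (m := m + 2) hhalf hw' i, eq_leftVec (m := m + 2) hhalf b2 i,
        padZero_one_eq_leftScale (m := m + 2) hc hw' hwn,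
        padZero_one_eq_leftScale (m := m + 2) hc b2
          (by rw [hpad]; exact inv_mul_cancel₀ hwc)]
    rw [ev, ew]

/-! ### Convergence -/

/-- The tail of column `0` in the weighted `ℓ¹` norm. -/
def colTail (m : ℕ) : ℝ := ∑' r, 3 ^ (r + m) * |parkingCol (r + m)|

theorem tendsto_colTail : Tendsto colTail atTop (𝓝 0) :=
  tendsto_sum_nat_add fun r => 3 ^ r * |parkingCol r|

theorem colTail_nonneg (m : ℕ) : 0 ≤ colTail m := tsum_nonneg fun _ => by positivity

theorem sum_Ico_le_colTail (m m' : ℕ) :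
    ∑ r ∈ Finset.Ico m m', 3 ^ r * |parkingCol r| ≤ colTail m := by
  rw [Finset.sum_Ico_eq_sum_range]
  simp_rw [add_comm m]
  exact ((summable_nat_add_iff (f := fun r => 3 ^ r * |parkingCol r|) m).2
    summable_pow_mul_abs_parkingCol).sum_le_tsum _ fun _ _ => by positivity

theorem sum_range_le_colTail (m : ℕ) :
    ∑ r ∈ Finset.range m, 3 ^ r * |parkingCol r| ≤ colTail 0 := by
  rw [Finset.range_eq_Ico]; exact sum_Ico_le_colTail 0 m

theorem norm_sum_leftSol_mul_le {l : ℝ} (hl : 6 / 5 ≤ l) (m m' : ℕ) :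
    ‖∑ r ∈ Finset.Ico m m', (leftSol l r : ℂ) * parkingCol r‖ ≤ 5 / 7 * colTail m := by
  refine (norm_sum_le _ _).trans (le_trans ?_
    (mul_le_mul_of_nonneg_left (sum_Ico_le_colTail m m') (by norm_num)))
  rw [Finset.mul_sum]
  refine Finset.sum_le_sum fun r _ => ?_
  rw [norm_mul, Complex.norm_real, Complex.norm_real, Real.norm_eq_abs, Real.norm_eq_abs]
  refine mul_le_mul ((abs_leftSol_le (by linarith) r).trans ?_)
    (le_mul_of_one_le_left (abs_nonneg _) (one_le_pow₀ (by norm_num))) (abs_nonneg _) (by norm_num)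
  rw [div_le_iff₀ (by linarith)]; linarith

/-- Pair the right eigenvector of the smaller truncation with the left one of the larger: `|l - l'|
/ 10 ≤ (5/7) * colTail (m + 2)`, and `50/7 ≤ 8`. -/
theorem IsMaxEigenvalue.abs_sub_le {m m' : ℕ} (hm : m ≤ m') {l l' : ℝ}
    (h : IsMaxEigenvalue (parkingTrunc (m + 3)) l)
    (h' : IsMaxEigenvalue (parkingTrunc (m' + 3)) l') : |l - l'| ≤ 8 * colTail (m + 2) := by
  obtain ⟨h1, h2, h3⟩ := h.charFun_eq_zero
  obtain ⟨h1', h2', h3'⟩ := h'.charFun_eq_zero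
  have hl : 6 / 5 ≤ ‖(l : ℂ)‖ := by
    rw [Complex.norm_real, Real.norm_eq_abs]; exact h1.trans (le_abs_self _)
  obtain ⟨v, hv, hne⟩ := exists_right_eigenvector (by linarith) h3
  have hv0 : (padZero v 0 : ℂ) ≠ 0 := fun h =>
    hne (eq_zero_of_padZero (by linarith) hv (Complex.ofReal_eq_zero.1 h))
  have hs := (isRightSystem_of_mulVec_real hv).smul (padZero v 0 : ℂ)⁻¹
  rw [inv_mul_cancel₀ hv0] at hs
  have hp := congrArg norm (hs.pairing (Nat.add_le_add_right hm 2) (by linarith) h3')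
  have hq := hs.norm_pairing_factor_ge hl h1' h2'
  rw [norm_mul, ← Complex.ofReal_sub, Complex.norm_real, Real.norm_eq_abs] at hp
  have hb := norm_sum_leftSol_mul_le h1' (m + 2) (m' + 2)
  rw [← hp] at hb
  have := mul_le_mul_of_nonneg_left hq (abs_nonneg (l - l'))
  linarith [colTail_nonneg (m + 2)]

theorem IsRightSystem.sum_sub_le {m m' : ℕ} (hm : m ≤ m') {l l' x₀ x₁ x₀' x₁' : ℂ}
    {x x' : ℕ → ℂ} (h : IsRightSystem m l x₀ x₁ x) (h' : IsRightSystem m' l' x₀' x₁' x')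
    (hx : ∀ r, m ≤ r → x r = 0) :
    (‖l'‖ - 1 / 2) * ∑ r ∈ Finset.range m', 3 ^ r * ‖x' r - x r‖ ≤
      ‖x₀' - x₀‖ * colTail 0 + ‖x₀‖ * colTail m +
        ‖l - l'‖ * ∑ r ∈ Finset.range m, 3 ^ r * ‖x r‖ := by
  have hsum : ∀ f : ℕ → ℂ, ∑ k ∈ Finset.range m', f k * x k = ∑ k ∈ Finset.range m, f k * x k :=
    fun f => (Finset.sum_subset (Finset.range_subset_range.2 hm) fun k _ hk => by
      rw [hx k (by simpa using hk), mul_zero]).symm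
  -- Padded by zeroes, `x` solves the larger block system with column `0` cut off at `m`:
  -- triangularity makes the new rows trivial. The difference `x' - x` then falls under the
  -- resolvent bound.
  have hx_block : ∀ r, l * x r = (if r < m then parkingCol r * x₀ else 0) +
      ∑ k ∈ Finset.range m', parkingBlock r k * x k := by
    intro r
    rw [hsum]
    split_ifs with hr
    · exact h.block r hr
    · rw [hx r (not_lt.1 hr), Finset.sum_eq_zero, mul_zero, add_zero]
      intro k hk
      rw [parkingBlock_eq_zero (lt_of_lt_of_le (Finset.mem_range.1 hk) (not_lt.1 hr))]
      simp
  refine (sum_norm_le_of_block (x := fun r => x' r - x r)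
    (z := fun r => parkingCol r * (x₀' - x₀) + (if r < m then 0 else parkingCol r * x₀) +
      (l - l') * x r) (by norm_num) fun r hr => ?_).trans ?_
  · have e1 := h'.block r hr
    have e2 := hx_block r
    simp_rw [mul_sub, Finset.sum_sub_distrib]
    split_ifs at e2 ⊢ <;> linear_combination e1 - e2
  · have hz : ∀ r, (3 : ℝ) ^ r * ‖(parkingCol r : ℂ) * (x₀' - x₀) +
        (if r < m then 0 else parkingCol r * x₀) + (l - l') * x r‖ ≤
        ‖x₀' - x₀‖ * (3 ^ r * |parkingCol r|) +
        ‖x₀‖ * (if r < m then 0 else 3 ^ r * |parkingCol r|) + ‖l - l'‖ * (3 ^ r * ‖x r‖) := by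
      intro r
      refine (mul_le_mul_of_nonneg_left norm_add₃_le (by positivity)).trans (le_of_eq ?_)
      split_ifs <;> simp only [norm_mul, norm_zero, Complex.norm_real, Real.norm_eq_abs] <;> ring
    refine (Finset.sum_le_sum fun r _ => hz r).trans ?_
    rw [Finset.sum_add_distrib, Finset.sum_add_distrib, ← Finset.mul_sum, ← Finset.mul_sum,
      ← Finset.mul_sum]
    refine add_le_add (add_le_add ?_ ?_) (le_of_eq ?_)
    · exact mul_le_mul_of_nonneg_left (sum_range_le_colTail m') (norm_nonneg _)
    · refine mul_le_mul_of_nonneg_left (le_trans (le_of_eq ?_) (sum_Ico_le_colTail m m'))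
        (norm_nonneg _)
      rw [← Finset.sum_range_add_sum_Ico _ hm, Finset.sum_eq_zero, zero_add]
      · exact Finset.sum_congr rfl fun r hr => if_neg (not_lt.2 (Finset.mem_Ico.1 hr).1)
      · exact fun r hr => if_pos (Finset.mem_range.1 hr)
    · congr 1
      refine (Finset.sum_subset (Finset.range_subset_range.2 hm) fun k _ hk => ?_).symm
      rw [hx k (by simpa using hk), norm_zero, mul_zero]

theorem abs_rightScale_le (c : ℕ) {l : ℝ} (hl : 6 / 5 ≤ l) : |rightScale c l| ≤ 2 := by
  unfold rightScale
  split_ifs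
  · norm_num
  · rw [abs_inv, abs_of_neg (by linarith), inv_le_comm₀ (by linarith) (by norm_num)]; linarith

theorem abs_rightScale_sub_le (c : ℕ) {l l' : ℝ} (hl : 6 / 5 ≤ l) (hl' : 6 / 5 ≤ l') :
    |rightScale c l' - rightScale c l| ≤ 3 * |l - l'| := by
  unfold rightScale
  split_ifs
  · simp
  · have h1 : (1 / 2 - l') ≠ 0 := by linarith
    have h2 : (1 / 2 - l) ≠ 0 := by linarith
    have h3 : 1 / 3 ≤ (1 / 2 - l') * (1 / 2 - l) := by nlinarith
    rw [inv_sub_inv h1 h2, abs_div, abs_of_pos (by linarith : 0 < (1 / 2 - l') * (1 / 2 - l)),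
      div_le_iff₀ (by linarith), show 1 / 2 - l - (1 / 2 - l') = -(l - l') by ring, abs_neg]
    nlinarith [abs_nonneg (l - l')]

theorem memEllOne_padZero {m : ℕ} (ρ : ℝ) (x : Fin m → ℝ) : MemEllOne ρ (padZero x) :=
  summable_of_ne_finset_zero (s := Finset.range m) fun i hi => by
    rw [padZero_of_le x (by simpa using hi), abs_zero, mul_zero]

/-- The factor collects `24 + 3 * 64 + 9 * (96 * colTail 0 + 4)`: entry `0`, entry `1` with weight
`3`, and the block with weight `9 = 3 ^ 2` for the index shift. -/
theorem IsMaxEigentriple.ellOneNorm_sub_le {m m' c : ℕ} (hc : c = 0 ∨ c = 1) (hm : m ≤ m')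
    {l l' : ℝ} {v w : Fin (m + 3 + 1) → ℝ} {v' w' : Fin (m' + 3 + 1) → ℝ}
    (h : IsMaxEigentriple (m + 3) c l v w) (h' : IsMaxEigentriple (m' + 3) c l' v' w') :
    ellOneNorm 3 (fun i => padZero v' i - padZero v i) ≤
      (252 + 864 * colTail 0) * colTail (m + 2) := by
  obtain ⟨h1, h2, -⟩ := h.isMax.charFun_eq_zero
  obtain ⟨h1', h2', -⟩ := h'.isMax.charFun_eq_zero
  have hd := h.isMax.abs_sub_le hm h'.isMax
  have hv0 := padZero_zero_eq_rightScale (m := m + 2) hc h.right h.right_norm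
  have hv0' := padZero_zero_eq_rightScale (m := m' + 2) hc h'.right h'.right_norm
  have hv1 := padZero_one_eq (m := m + 2) h.right
  have hv1' := padZero_one_eq (m := m' + 2) h'.right
  have hs := isRightSystem_of_mulVec_real (m := m + 2) h.right
  have hs' := isRightSystem_of_mulVec_real (m := m' + 2) h'.right
  have hb := hs.sum_norm_le (ρ := 3) (by norm_num)
  have hD := hs.sum_sub_le (Nat.add_le_add_right hm 2) hs' fun r hr => by
    rw [padZero_of_le v (by omega), Complex.ofReal_zero]
  simp only [← Complex.ofReal_sub, Complex.norm_real, Real.norm_eq_abs] at hb hD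
  rw [abs_of_pos (by linarith : 0 < l)] at hb
  rw [abs_of_pos (by linarith : 0 < l')] at hD
  have hS := sum_range_le_colTail (m + 2)
  have hS0 := colTail_nonneg 0
  have hτ := colTail_nonneg (m + 2)
  have hx0 : |padZero v 0| ≤ 2 := by rw [hv0]; exact abs_rightScale_le c h1
  have hdx0 : |padZero v' 0 - padZero v 0| ≤ 24 * colTail (m + 2) := by
    rw [hv0, hv0']; linarith [abs_rightScale_sub_le c h1 h1']
  have hdx1 : |padZero v' 1 - padZero v 1| ≤ 64 * colTail (m + 2) := by
    rw [hv1, hv1', show (1 / 2 - l') * padZero v' 0 - (1 / 2 - l) * padZero v 0 =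
      (1 / 2 - l') * (padZero v' 0 - padZero v 0) + (l - l') * padZero v 0 by ring]
    refine (abs_add_le _ _).trans ?_
    rw [abs_mul, abs_mul]
    have a1 : |1 / 2 - l'| ≤ 2 := by rw [abs_le]; constructor <;> linarith
    have a2 := mul_le_mul a1 hdx0 (abs_nonneg _) (by norm_num)
    have a3 := mul_le_mul hd hx0 (abs_nonneg _) (by positivity)
    linarith
  set X := ∑ r ∈ Finset.range (m + 2), 3 ^ r * |padZero v (r + 2)|
  set D := ∑ r ∈ Finset.range (m' + 2), 3 ^ r * |padZero v' (r + 2) - padZero v (r + 2)|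
  have hX0 : 0 ≤ X := Finset.sum_nonneg fun _ _ => by positivity
  have hD0 : 0 ≤ D := Finset.sum_nonneg fun _ _ => by positivity
  have hX : X ≤ 3 * colTail 0 := by
    have a1 : |padZero v 0| * ∑ r ∈ Finset.range (m + 2), 3 ^ r * |parkingCol r| ≤
        2 * colTail 0 :=
      mul_le_mul hx0 hS (Finset.sum_nonneg fun _ _ => by positivity) (by norm_num)
    have a2 : 7 / 10 * X ≤ (l - 1 / 2) * X := mul_le_mul_of_nonneg_right (by linarith) hX0
    linarith
  have hDle : D ≤ (96 * colTail 0 + 4) * colTail (m + 2) := by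
    have a1 := mul_le_mul_of_nonneg_right hdx0 hS0
    have a2 := mul_le_mul_of_nonneg_right hx0 hτ
    have a3 : |l - l'| * X ≤ 8 * colTail (m + 2) * (3 * colTail 0) :=
      mul_le_mul hd hX hX0 (by positivity)
    have a4 : 1 / 2 * D ≤ (l' - 1 / 2) * D := mul_le_mul_of_nonneg_right (by linarith) hD0
    linarith
  have hsum : ellOneNorm 3 (fun i => padZero v' i - padZero v i) =
      |padZero v' 0 - padZero v 0| + 3 * |padZero v' 1 - padZero v 1| + 9 * D := by
    unfold ellOneNorm
    rw [tsum_eq_sum (s := Finset.range (m' + 2 + 2)), sum_range_add_two, Finset.mul_sum]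
    · simp only [pow_zero, pow_one, one_mul]
      congr 1
      exact Finset.sum_congr rfl fun r _ => by ring
    · intro i hi
      have hi' : m' + 2 + 2 ≤ i := by simpa using hi
      simp only
      rw [padZero_of_le v' (by omega), padZero_of_le v (by omega), sub_zero, abs_zero, mul_zero]
  rw [hsum]
  linarith

/-- Multiplication by `ρ ^ i` is an isometry of `ℓ¹_ρ` onto `ℓ¹`, which is complete. -/
theorem exists_ellOne_limit {ρ : ℝ} (hρ : 0 < ρ) {u : ℕ → ℕ → ℝ} (hu : ∀ n, MemEllOne ρ (u n))
    {b : ℕ → ℝ} (hb : Tendsto b atTop (𝓝 0))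
    (h : ∀ n m, n ≤ m → ellOneNorm ρ (fun i => u m i - u n i) ≤ b n) :
    ∃ x : ℕ → ℝ, MemEllOne ρ x ∧
      Tendsto (fun n => ellOneNorm ρ (fun i => u n i - x i)) atTop (𝓝 0) := by
  have hmem : ∀ n, Memℓp (fun i => ρ ^ i * u n i) 1 := fun n => by
    refine memℓp_gen ?_
    simpa [abs_mul, abs_of_pos hρ, MemEllOne] using hu n
  have hnorm : ∀ f : lp (fun _ : ℕ => ℝ) 1, ‖f‖ = ∑' i, |f i| := fun f => by
    rw [lp.norm_eq_tsum_rpow (by norm_num)]; simp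
  let f : ℕ → lp (fun _ : ℕ => ℝ) 1 := fun n => ⟨_, hmem n⟩
  have hf : ∀ n i, f n i = ρ ^ i * u n i := fun _ _ => rfl
  have hcauchy : CauchySeq f := by
    refine cauchySeq_of_le_tendsto_0' b (fun n m hnm => ?_) hb
    rw [dist_comm, dist_eq_norm, hnorm]
    refine le_trans (le_of_eq (tsum_congr fun i => ?_)) (h n m hnm)
    rw [lp.coeFn_sub, Pi.sub_apply, hf, hf, ← mul_sub, abs_mul, abs_of_pos (pow_pos hρ i)]
  obtain ⟨g, hg⟩ := cauchySeq_tendsto_of_complete hcauchy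
  refine ⟨fun i => g i / ρ ^ i, ?_, ?_⟩
  · have := (lp.memℓp g).summable (by norm_num)
    refine this.congr fun i => ?_
    rw [abs_div, abs_of_pos (pow_pos hρ i), mul_div_cancel₀ _ (pow_pos hρ i).ne']
    simp
  · refine (tendsto_iff_norm_sub_tendsto_zero.1 hg).congr fun n => ?_
    rw [hnorm]
    refine tsum_congr fun i => ?_
    rw [lp.coeFn_sub, Pi.sub_apply, hf, ← abs_of_pos (pow_pos hρ i), ← abs_mul,
      abs_of_pos (pow_pos hρ i), mul_sub, mul_div_cancel₀ _ (pow_pos hρ i).ne']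

theorem MemEllOne.mono {ρ σ : ℝ} (hρ : 0 ≤ ρ) (h : ρ ≤ σ) {x : ℕ → ℝ} (hx : MemEllOne σ x) :
    MemEllOne ρ x :=
  Summable.of_nonneg_of_le (fun _ => by positivity) (fun i => by gcongr) hx

theorem ellOneNorm_mono {ρ σ : ℝ} (hρ : 0 ≤ ρ) (h : ρ ≤ σ) {x : ℕ → ℝ} (hx : MemEllOne σ x) :
    ellOneNorm ρ x ≤ ellOneNorm σ x :=
  (hx.mono hρ h).tsum_le_tsum (fun i => by gcongr) hx

theorem MemEllOne.sub {ρ : ℝ} (hρ : 0 ≤ ρ) {x y : ℕ → ℝ} (hx : MemEllOne ρ x)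
    (hy : MemEllOne ρ y) : MemEllOne ρ (fun i => x i - y i) := by
  refine Summable.of_nonneg_of_le (fun _ => by positivity) (fun i => ?_) (Summable.add hx hy)
  rw [← mul_add]
  exact mul_le_mul_of_nonneg_left (abs_sub _ _) (by positivity)

/-! ### Uniform convergence of the left eigenvectors, and the limits assembled -/

theorem tendsto_leftVec {l : ℝ} (hl : 1 ≤ l) : Tendsto (leftVec l) atTop (𝓝 0) :=
  (tendsto_add_atTop_iff_nat 2).1 (tendsto_leftSol hl)

theorem abs_leftVec_le {l : ℝ} (hl : 6 / 5 ≤ l) (hl2 : l ≤ 2) (i : ℕ) : |leftVec l i| ≤ 1 := by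
  match i with
  | 0 =>
    simp only [leftVec, abs_le]
    constructor <;> linarith [parkingDiag_gt, parkingDiag_lt]
  | 1 => simp [leftVec]
  | k + 2 =>
    refine (abs_leftSol_le (by linarith) k).trans ?_
    rw [div_le_iff₀ (by linarith)]; linarith

theorem abs_leftVec_sub_le {l l' : ℝ} (hl : 6 / 5 ≤ l) (hl' : 6 / 5 ≤ l') (i : ℕ) :
    |leftVec l i - leftVec l' i| ≤ 2 * |l - l'| := by
  match i with
  | 0 =>
    simp only [leftVec]
    rw [show parkingDiag - l - (parkingDiag - l') = -(l - l') by ring, abs_neg]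
    linarith [abs_nonneg (l - l')]
  | 1 => simp [leftVec]
  | k + 2 =>
    refine (abs_leftSol_sub_le (by linarith) (by linarith) k).trans ?_
    have h1 : 1 / 2 / (l' - 1 / 2) ≤ 1 := by rw [div_le_iff₀ (by linarith)]; linarith
    rw [div_le_iff₀ (by linarith), abs_sub_comm l']
    have h2 := mul_le_mul_of_nonneg_left h1 (abs_nonneg (l - l'))
    have h3 := mul_le_mul_of_nonneg_left hl (abs_nonneg (l - l'))
    linarith [abs_nonneg (l - l')]

theorem continuousAt_leftScale (c : ℕ) {l : ℝ} (hl : 6 / 5 ≤ l) :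
    ContinuousAt (leftScale c) l := by
  unfold leftScale
  split_ifs
  · exact ContinuousAt.inv₀ (by fun_prop) (by linarith [parkingDiag_lt])
  · exact continuousAt_const

theorem IsMaxEigentriple.padZero_left {m c : ℕ} (hc : c = 0 ∨ c = 1) {l : ℝ}
    {v w : Fin (m + 3 + 1) → ℝ} (h : IsMaxEigentriple (m + 3) c l v w) {i : ℕ} (hi : i < m + 4) :
    padZero w i = leftScale c l * leftVec l i := by
  obtain ⟨h1, -, -⟩ := h.isMax.charFun_eq_zero
  rw [padZero_of_lt w hi, eq_leftVec (m := m + 2) (by linarith) h.left,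
    padZero_one_eq_leftScale (m := m + 2) hc h.left h.left_norm]

theorem exists_tendsto_padEllInfty {c M : ℕ} (hc : c = 0 ∨ c = 1) {lam : ℕ → ℝ}
    {v w : (n : ℕ) → Fin (n + M + 3 + 1) → ℝ}
    (H : ∀ n, IsMaxEigentriple (n + M + 3) c (lam n) (v n) (w n)) {L : ℝ}
    (hL : Tendsto lam atTop (𝓝 L)) :
    ∃ wLim : lp (fun _ : ℕ => ℝ) ∞, Tendsto (fun n => padEllInfty (w n)) atTop (𝓝 wLim) := by
  have hl : ∀ n, 6 / 5 ≤ lam n ∧ lam n ≤ 2 := fun n =>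
    ⟨(H n).isMax.charFun_eq_zero.1, (H n).isMax.charFun_eq_zero.2.1⟩
  have hL1 : 6 / 5 ≤ L := ge_of_tendsto' hL fun n => (hl n).1
  have hL2 : L ≤ 2 := le_of_tendsto' hL fun n => (hl n).2
  have hx : Tendsto (fun i => leftScale c L * leftVec L i) atTop (𝓝 0) := by
    simpa using (tendsto_leftVec (by linarith : 1 ≤ L)).const_mul (leftScale c L)
  refine ⟨⟨fun i => leftScale c L * leftVec L i, memℓp_infty hx.norm.bddAbove_range⟩, ?_⟩
  have ht : Tendsto (fun n => leftScale c (lam n)) atTop (𝓝 (leftScale c L)) :=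
    (continuousAt_leftScale c hL1).tendsto.comp hL
  have he : Tendsto (fun n => |leftScale c (lam n) - leftScale c L| +
      |leftScale c L| * (2 * |lam n - L|)) atTop (𝓝 0) := by
    have := ((ht.sub_const (leftScale c L)).abs).add
      ((((hL.sub_const L).abs).const_mul 2).const_mul |leftScale c L|)
    simpa using this
  rw [Metric.tendsto_atTop]
  intro ε hε
  obtain ⟨N₁, h₁⟩ := eventually_atTop.1 (he.eventually (gt_mem_nhds (half_pos hε)))
  obtain ⟨N₂, h₂⟩ := Metric.tendsto_atTop.1 hx (ε / 2) (half_pos hε)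
  refine ⟨max N₁ N₂, fun n hn => ?_⟩
  rw [dist_eq_norm]
  refine lt_of_le_of_lt (lp.norm_le_of_forall_le (half_pos hε).le fun i => ?_) (half_lt_self hε)
  change |padZero (w n) i - leftScale c L * leftVec L i| ≤ ε / 2
  -- Inside the truncation, the Lipschitz bound in the eigenvalue applies uniformly in `i`; outside,
  -- the padded vector is zero and the limit itself is small.
  rcases lt_or_ge i (n + M + 4) with hi | hi
  · rw [(H n).padZero_left hc hi]
    refine le_trans ?_ (h₁ n (le_of_max_le_left hn)).le
    rw [show leftScale c (lam n) * leftVec (lam n) i - leftScale c L * leftVec L i =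
      (leftScale c (lam n) - leftScale c L) * leftVec (lam n) i +
        leftScale c L * (leftVec (lam n) i - leftVec L i) by ring]
    refine (abs_add_le _ _).trans ?_
    rw [abs_mul, abs_mul]
    exact add_le_add (mul_le_of_le_one_right (abs_nonneg _) (abs_leftVec_le (hl n).1 (hl n).2 i))
      (mul_le_mul_of_nonneg_left (abs_leftVec_sub_le (hl n).1 hL1 i) (abs_nonneg _))
  · rw [padZero_of_le _ hi, zero_sub, abs_neg]
    have := h₂ i (by have := le_of_max_le_right hn; omega)
    rw [Real.dist_eq, sub_zero] at this
    exact this.le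

theorem exists_tendsto_of_isMaxEigentriple {c M : ℕ} (hc : c = 0 ∨ c = 1) {lam : ℕ → ℝ}
    {v w : (n : ℕ) → Fin (n + M + 3 + 1) → ℝ}
    (H : ∀ n, IsMaxEigentriple (n + M + 3) c (lam n) (v n) (w n)) :
    (∃ L : ℝ, Tendsto lam atTop (𝓝 L)) ∧
    (∃ x : ℕ → ℝ, ∀ ρ : ℝ, 1 ≤ ρ → ρ ≤ 3 → MemEllOne ρ x ∧
      Tendsto (fun n => ellOneNorm ρ (fun i => padZero (v n) i - x i)) atTop (𝓝 0)) := by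
  have hτ : Tendsto (fun n => colTail (n + M + 2)) atTop (𝓝 0) :=
    (tendsto_add_atTop_iff_nat (M + 2)).2 tendsto_colTail
  constructor
  · refine cauchySeq_tendsto_of_complete
      (cauchySeq_of_le_tendsto_0' (fun n => 8 * colTail (n + M + 2)) (fun n m hnm => ?_) ?_)
    · rw [Real.dist_eq]
      exact (H n).isMax.abs_sub_le (by omega) (H m).isMax
    · simpa using hτ.const_mul 8
  · have hb := hτ.const_mul (252 + 864 * colTail 0)
    rw [mul_zero] at hb
    -- The limit in the strongest norm, `ρ = 3`, serves for all smaller weights.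
    obtain ⟨x, hx, hlim⟩ := exists_ellOne_limit (ρ := 3) (by norm_num)
      (fun n => memEllOne_padZero 3 (v n)) hb
      (fun n m hnm => (H n).ellOneNorm_sub_le hc (by omega) (H m))
    refine ⟨x, fun ρ h1 h3 => ⟨hx.mono (by linarith) h3, ?_⟩⟩
    refine squeeze_zero (fun n => tsum_nonneg fun i => by positivity) (fun n => ?_) hlim
    exact ellOneNorm_mono (by linarith) h3
      ((memEllOne_padZero 3 (v n)).sub (by norm_num) hx)

end

theorem mainTheorem6 (c : ℕ) (hc : c = 0 ∨ c = 1) :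
    (∀ n : ℕ, 7 ≤ n →
      ∃! t : ℝ × (Fin (n + 1) → ℝ) × (Fin (n + 1) → ℝ),
        IsMaxEigentriple n c t.1 t.2.1 t.2.2) ∧
    ∀ (lam : ℕ → ℝ) (v w : (n : ℕ) → Fin (n + 1) → ℝ),
      (∀ᶠ n in atTop, IsMaxEigentriple n c (lam n) (v n) (w n)) →
        (∃ lamLim : ℝ, Tendsto lam atTop (𝓝 lamLim)) ∧
        (∃ vLim : ℕ → ℝ, ∀ ρ : ℝ, 1 ≤ ρ → ρ ≤ 3 →
          MemEllOne ρ vLim ∧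
          Tendsto (fun n => ellOneNorm ρ (fun i => padZero (v n) i - vLim i)) atTop (𝓝 0)) ∧
        (∃ wLim : lp (fun _ : ℕ => ℝ) ∞,
          Tendsto (fun n => padEllInfty (w n)) atTop (𝓝 wLim)) := by
  refine ⟨fun n hn => ?_, fun lam v w h => ?_⟩
  -- The sign change needs only two block columns, so the argument already works from `n = 3`.
  · obtain ⟨m, rfl⟩ := Nat.exists_eq_add_of_le' (show 3 ≤ n by omega)
    exact existsUnique_isMaxEigentriple hc m
  · obtain ⟨M, hM⟩ := eventually_atTop.1 h
    have H : ∀ n, IsMaxEigentriple (n + M + 3) c (lam (n + M + 3)) (v (n + M + 3))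
        (w (n + M + 3)) := fun n => hM _ (by omega)
    obtain ⟨⟨L, hL⟩, x, hx⟩ := exists_tendsto_of_isMaxEigentriple hc H
    obtain ⟨y, hy⟩ := exists_tendsto_padEllInfty hc H hL
    refine ⟨⟨L, (tendsto_add_atTop_iff_nat (M + 3)).1 hL⟩, ⟨x, fun ρ h1 h3 =>
      ⟨(hx ρ h1 h3).1, ?_⟩⟩, ⟨y, ?_⟩⟩
    · exact (tendsto_add_atTop_iff_nat
        (f := fun n => ellOneNorm ρ (fun i => padZero (v n) i - x i)) (M + 3)).1 (hx ρ h1 h3).2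
    · exact (tendsto_add_atTop_iff_nat (f := fun n => padEllInfty (w n)) (M + 3)).1 hy
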